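/- For a complex square matrix $A$ and $p\ge 1$ let $\|A\|_p=(\mathrm{Tr}\,|A|^p)^{1/p}$, where $|A|=(A^*A)^{1/2}$. For a linear map $L:\mathcal M_m\to\mathcal M_n$ between algebras of complex square matrices let $\|L\|_{p\to q}=\sup_{A\ne 0}\|L(A)\|_q/\|A\|_p$, the supremum being over all complex $m\times m$ matrices (and $0$ if $m=0$). A linear map $\Phi:\mathcal M_d\to\mathcal M_{d'}$ is called fully $(p\to q)$-multiplicative, $FM(p,q)$, if for all $e,e'$ and every completely positive map $\Omega:\mathcal M_e\to\mathcal M_{e'}$, $$\|\Phi\otimes\Omega\|_{p\to q}=\|\Phi\|_{p\to q}\,\|\Omega\|_{p\to q}.$$ Let $X_1,\dots,X_N\in\mathcal M_d$ and $R_1,\dots,R_N\in\mathcal M_{d'}$ be positive semidefinite, and let $\Phi:\mathcal M_d\to\mathcal M_{d'}$ be the entanglement-breaking map $\Phi(A)=\sum_{k=1}^N\mathrm{Tr}(AX_k)\,R_k$. (1) If all entries of all the matrices $X_k$ are real and nonnegative, or if all the matrices $R_k$ are diagonal, then $\Phi$ is $FM(2,q)$ for every real $q>2$. (2) In particular this holds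 for CQ and QC maps: if $X_k=|\psi_k\rangle\langle\psi_k|$ for some orthonormal basis $\psi_1,\dots,\psi_N$ of $\mathbb C^d$, or if $R_k=|\phi_k\rangle\langle\phi_k|$ for some orthonormal basis $\phi_1,\dots,\phi_N$ of $\mathbb C^{d'}$, then $\Phi$ is $FM(2,q)$ for every real $q>2$. (3) Dually, if all entries of all the matrices $R_k$ are real and nonnegative, or if all the matrices $X_k$ are diagonal, then $\Phi$ is $FM(p,2)$ for every real $p$ with $1\le p<2$. -/

import Mathlib

open scoped ComplexOrder MatrixOrder

noncomputable section

namespace MatrixMaps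

/-- The Schatten norm `‖A‖_p = (Tr |A|^p)^(1/p)` of a complex matrix, where `|A| = (Aᴴ A)^(1/2)`
and powers of positive semidefinite matrices are taken through the functional calculus. -/
def schattenNorm {n : Type*} [Fintype n] [DecidableEq n] (p : ℝ) (A : Matrix n n ℂ) : ℝ :=
  ((CFC.abs A ^ p : Matrix n n ℂ).trace.re) ^ (1 / p)

/-- The `p → q` norm `sup_A ‖L(A)‖_q / ‖A‖_p` of a linear map between matrix algebras, as a
supremum in `[0, ∞]` over all complex matrices `A` (the matrix `A = 0` contributes `0`). -/
def normPQ {m n : Type*} [Fintype m] [DecidableEq m] [Fintype n] [DecidableEq n] (p q : ℝ)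
    (L : Matrix m m ℂ →ₗ[ℂ] Matrix n n ℂ) : ENNReal :=
  ⨆ A : Matrix m m ℂ, ENNReal.ofReal (schattenNorm q (L A) / schattenNorm p A)

/-- The tensor product `L ⊗ K` of linear maps between matrix algebras, with `M_m ⊗ M_n` identified
with the matrices indexed by `m × n` through the Kronecker product. -/
def tensorMap {m m' n n' : Type*} [Fintype m] [DecidableEq m] [Fintype m'] [DecidableEq m']
    [Fintype n] [DecidableEq n] [Fintype n'] [DecidableEq n']
    (L : Matrix m m ℂ →ₗ[ℂ] Matrix m' m' ℂ) (K : Matrix n n ℂ →ₗ[ℂ] Matrix n' n' ℂ) :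
    Matrix (m × n) (m × n) ℂ →ₗ[ℂ] Matrix (m' × n') (m' × n') ℂ :=
  (kroneckerLinearEquiv m' m' n' n' ℂ).toLinearMap ∘ₗ TensorProduct.map L K ∘ₗ
    (kroneckerLinearEquiv m m n n ℂ).symm.toLinearMap

theorem tensorMap_kronecker {m m' n n' : Type*} [Fintype m] [DecidableEq m] [Fintype m']
    [DecidableEq m'] [Fintype n] [DecidableEq n] [Fintype n'] [DecidableEq n']
    (L : Matrix m m ℂ →ₗ[ℂ] Matrix m' m' ℂ) (K : Matrix n n ℂ →ₗ[ℂ] Matrix n' n' ℂ)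
    (A : Matrix m m ℂ) (B : Matrix n n ℂ) :
    tensorMap L K (Matrix.kronecker A B) = Matrix.kronecker (L A) (K B) := by
  simp [tensorMap]

/-- A linear map `L` between matrix algebras is completely positive if `L ⊗ id_k` maps positive
semidefinite matrices to positive semidefinite matrices, for every `k`. -/
def IsCP {m n : Type*} [Fintype m] [DecidableEq m] [Fintype n] [DecidableEq n]
    (L : Matrix m m ℂ →ₗ[ℂ] Matrix n n ℂ) : Prop :=
  ∀ (k : ℕ) (A : Matrix (m × Fin k) (m × Fin k) ℂ), A.PosSemidef →
    (tensorMap L (LinearMap.id : Matrix (Fin k) (Fin k) ℂ →ₗ[ℂ] _) A).PosSemidef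

/-- `FM(p, q)`: the map `Φ` is fully `(p → q)`-multiplicative, that is,
`‖Φ ⊗ Ω‖_{p→q} = ‖Φ‖_{p→q} ‖Ω‖_{p→q}` for every completely positive map `Ω` from `M_e` to `M_e'`,
in all dimensions `e`, `e'`. -/
def FullyMultiplicative {m n : Type*} [Fintype m] [DecidableEq m] [Fintype n] [DecidableEq n]
    (p q : ℝ) (Φ : Matrix m m ℂ →ₗ[ℂ] Matrix n n ℂ) : Prop :=
  ∀ (e e' : ℕ) (Ω : Matrix (Fin e) (Fin e) ℂ →ₗ[ℂ] Matrix (Fin e') (Fin e') ℂ), IsCP Ω →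
    normPQ p q (tensorMap Φ Ω) = normPQ p q Φ * normPQ p q Ω

/-- The map `A ↦ ∑ k, Tr (A X_k) R_k`. -/
def ebMap {d d' N : ℕ} (X : Fin N → Matrix (Fin d) (Fin d) ℂ)
    (R : Fin N → Matrix (Fin d') (Fin d') ℂ) :
    Matrix (Fin d) (Fin d) ℂ →ₗ[ℂ] Matrix (Fin d') (Fin d') ℂ where
  toFun A := ∑ k, (A * X k).trace • R k
  map_add' A B := by simp [add_mul, add_smul, Finset.sum_add_distrib]
  map_smul' c A := by simp [Finset.smul_sum, smul_smul]

/-- The matrices `X_k` are the rank-one projections `|ψ_k⟩⟨ψ_k|` onto the vectors of some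
orthonormal basis of `ℂ^d` (not necessarily the standard one). -/
def IsBasisProjections {d N : ℕ} (X : Fin N → Matrix (Fin d) (Fin d) ℂ) : Prop :=
  ∃ ψ : OrthonormalBasis (Fin N) ℂ (EuclideanSpace ℂ (Fin d)),
    ∀ k, X k = Matrix.of fun i j => ψ k i * star (ψ k j)

end MatrixMaps

end

/-!
Write `Φ(A) = ∑ Tr(A X_k) R_k`. Then `(Φ ⊗ Ω)(M) = ∑ R_k ⊗ Ω(M_k)`, where `M_k` is the partial trace
`Tr₁ ((X_k ⊗ 1) M)` (`slice`). The inequality `≥` in the multiplicativity formula comes from product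
matrices `A ⊗ B`. For `≤`, the key fact (`schattenNorm_sum_kronecker_le`) is that for `R_k ≥ 0` and
arbitrary `B_k` with `‖B_k‖_q ≤ b_k`
`‖∑ R_k ⊗ B_k‖_q ≤ ‖∑ b_k R_k‖_q`.
To prove it, rescale to `b_k = 1`, put `T = ∑ R_k + ε`, and write `R_k = T^(1/2) Q_k T^(1/2)` with
`∑ Q_k ≤ 1` and `B_k = U_k β_k V_k` with unitary `U_k`, `V_k` and `β_k ≥ 0` diagonal. Replace
`T^(1/2)` by `T^(qz/2)` and `β_k` by `β_k^(qz)`. On the line `Re z = 0` the resulting sum is a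
contraction, on `Re z = 1` its trace norm is at most `Tr T^q`, and the three lines theorem gives the
bound at `z = 1/q` (`norm_trace_interpolation_le`). Then let `ε` tend to `0`.

It then remains to compare `‖∑ ‖M_k‖_2 R_k‖_q` with `‖Φ‖_{2→q} ‖M‖_2`.
* If the `X_k` are entrywise nonnegative, the triangle inequality gives `‖M_k‖_2 ≤ Tr(m X_k)` for
  the matrix `m` of the Hilbert–Schmidt norms of the blocks of `M`, and `‖m‖_2 = ‖M‖_2`. If the `X_k`
  are the projections onto an orthonormal basis, `m = ∑ ‖M_k‖_2 X_k` serves the same purpose.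
* If the `R_k` are diagonal, possibly in another orthonormal basis, `Φ` is a map into `ℓ_q`, and
  Minkowski's inequality in `ℓ_{q/2}` gives the comparison (`Lq_sqrt_sum_sq_le`).

The statement about `p → 2` norms follows for `p > 1` by transposition with respect to the trace
pairing, which exchanges the `X_k` and the `R_k`, and for `p = 1` by letting `p` decrease to `1`.
-/

open scoped ComplexOrder MatrixOrder

namespace MatrixMaps

open Matrix
open scoped Kronecker

/-! ### Singular values -/

section SingularValues

variable {n : Type*} [Fintype n] [DecidableEq n]

theorem trace_rpow_conj_diagonal {V : Matrix n n ℂ} (hV : V ∈ unitaryGroup n ℂ) {s : n → ℝ}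
    (hs : ∀ i, 0 ≤ s i) (p : ℝ) :
    ((Vᴴ * diagonal (fun i => (s i : ℂ)) * V) ^ p : Matrix n n ℂ).trace
      = ((∑ i, s i ^ p : ℝ) : ℂ) := by
  have hVV : V * Vᴴ = 1 := mem_unitaryGroup_iff.1 hV
  set H : Matrix n n ℂ := Vᴴ * diagonal (fun i => (s i : ℂ)) * V with hH
  have hpos : H.PosSemidef := by
    refine PosSemidef.conjTranspose_mul_mul_same (PosSemidef.diagonal fun i => ?_) V
    simpa using hs i
  have hherm := hpos.isHermitian
  have hroots : Multiset.map (fun i => ((hherm.eigenvalues i : ℝ) : ℂ)) Finset.univ.val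
      = Multiset.map (fun i => ((s i : ℝ) : ℂ)) Finset.univ.val := by
    have h1 := hherm.roots_charpoly_eq_eigenvalues
    have h2 : H.charpoly = (diagonal (fun i => (s i : ℂ))).charpoly := by
      rw [hH, charpoly_mul_comm, ← mul_assoc, hVV, one_mul]
    rw [h2, charpoly_diagonal, Polynomial.roots_prod _ _
      (Finset.prod_ne_zero_iff.2 fun i _ => Polynomial.X_sub_C_ne_zero _)] at h1
    simpa [Function.comp_def] using h1.symm
  have hroots' : Multiset.map hherm.eigenvalues Finset.univ.val
      = Multiset.map s Finset.univ.val := by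
    have := congrArg (Multiset.map Complex.re) hroots
    simpa only [Multiset.map_map, Function.comp_def, Complex.ofReal_re] using this
  have hsum : ∑ i, hherm.eigenvalues i ^ p = ∑ i, s i ^ p := by
    have := congrArg (fun t => (Multiset.map (fun x : ℝ => x ^ p) t).sum) hroots'
    simpa only [Multiset.map_map, Function.comp_def, Finset.sum] using this
  rw [CFC.rpow_eq_cfc_real (a := H) (y := p) (nonneg_iff_posSemidef.2 hpos), hherm.cfc_eq,
    IsHermitian.cfc, ← hsum]
  rw [Unitary.conjStarAlgAut_apply, trace_mul_cycle]
  simp [trace]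

theorem abs_of_svd {U V : Matrix n n ℂ} (hU : U ∈ unitaryGroup n ℂ) {s : n → ℝ}
    (hs : ∀ i, 0 ≤ s i) (hV : V ∈ unitaryGroup n ℂ) :
    CFC.abs (U * diagonal (fun i => (s i : ℂ)) * V)
      = Vᴴ * diagonal (fun i => (s i : ℂ)) * V := by
  have hVV : V * Vᴴ = 1 := mem_unitaryGroup_iff.1 hV
  have hUU : Uᴴ * U = 1 := mem_unitaryGroup_iff'.1 hU
  have hpos : (Vᴴ * diagonal (fun i => (s i : ℂ)) * V).PosSemidef := by
    refine PosSemidef.conjTranspose_mul_mul_same (PosSemidef.diagonal fun i => ?_) V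
    simpa using hs i
  rw [CFC.abs]
  refine CFC.sqrt_unique ?_ (nonneg_iff_posSemidef.2 hpos)
  have hD : (diagonal (fun i => (s i : ℂ)))ᴴ = diagonal (fun i => (s i : ℂ)) := by
    rw [diagonal_conjTranspose]; congr 1; ext i; simp
  rw [star_eq_conjTranspose, conjTranspose_mul, conjTranspose_mul, hD]
  calc _ = Vᴴ * diagonal (fun i => (s i : ℂ)) * (V * Vᴴ) * diagonal (fun i => (s i : ℂ)) * V := by
        simp only [mul_assoc]
    _ = Vᴴ * diagonal (fun i => (s i : ℂ)) * (Uᴴ * U) * diagonal (fun i => (s i : ℂ)) * V := by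
        rw [hVV, hUU]
    _ = _ := by simp only [mul_assoc]

/-- The Schatten norm is the `ℓ_p` norm of the singular values. -/
theorem schattenNorm_svd (p : ℝ) {U V : Matrix n n ℂ} (hU : U ∈ unitaryGroup n ℂ) {s : n → ℝ}
    (hs : ∀ i, 0 ≤ s i) (hV : V ∈ unitaryGroup n ℂ) :
    schattenNorm p (U * diagonal (fun i => (s i : ℂ)) * V) = (∑ i, s i ^ p) ^ (1 / p) := by
  rw [schattenNorm, abs_of_svd hU hs hV, trace_rpow_conj_diagonal hV hs, Complex.ofReal_re]

/-- Singular value decomposition of a square matrix. -/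
theorem exists_svd (A : Matrix n n ℂ) : ∃ U ∈ unitaryGroup n ℂ, ∃ V ∈ unitaryGroup n ℂ,
    ∃ s : n → ℝ, (∀ i, 0 ≤ s i) ∧ A = U * diagonal (fun i => (s i : ℂ)) * V := by
  have hpos := posSemidef_conjTranspose_mul_self A
  have hherm := hpos.isHermitian
  set W : Matrix n n ℂ := hherm.eigenvectorUnitary.1 with hW
  have hWm : W ∈ unitaryGroup n ℂ := hherm.eigenvectorUnitary.2
  have hWW : W * Wᴴ = 1 := mem_unitaryGroup_iff.1 hWm
  have hWW' : Wᴴ * W = 1 := mem_unitaryGroup_iff'.1 hWm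
  set l := hherm.eigenvalues with hl
  have hl0 : ∀ i, 0 ≤ l i := hpos.eigenvalues_nonneg
  set s : n → ℝ := fun i => √(l i) with hs
  have hs2 : ∀ i, s i ^ 2 = l i := fun i => Real.sq_sqrt (hl0 i)
  have hspec : Aᴴ * A = W * diagonal (fun i => (l i : ℂ)) * Wᴴ := by
    have := hherm.spectral_theorem
    rw [Unitary.conjStarAlgAut_apply] at this
    exact this
  -- the columns of `G` are orthogonal, with lengths the singular values
  set G := A * W with hG
  have hGG : Gᴴ * G = diagonal (fun i => (l i : ℂ)) := by
    calc Gᴴ * G = Wᴴ * (Aᴴ * A) * W := by simp only [hG, conjTranspose_mul, mul_assoc]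
      _ = (Wᴴ * W) * diagonal (fun i => (l i : ℂ)) * (Wᴴ * W) := by
        rw [hspec]; simp only [mul_assoc]
      _ = _ := by rw [hWW']; simp
  let g : n → EuclideanSpace ℂ n := fun j => WithLp.toLp 2 (fun i => G i j)
  have hg : ∀ i j, inner ℂ (g i) (g j) = if i = j then (l i : ℂ) else 0 := by
    intro i j
    have := congrFun (congrFun hGG i) j
    simp only [mul_apply, conjTranspose_apply, diagonal_apply] at this
    rw [← this]
    simp [g, PiLp.inner_apply, mul_comm]
  let v : n → EuclideanSpace ℂ n := fun j => ((s j)⁻¹ : ℂ) • g j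
  have hv : Orthonormal ℂ ({j | s j ≠ 0}.domRestrict v) := by
    rw [orthonormal_iff_ite]
    rintro ⟨i, hi⟩ ⟨j, hj⟩
    change inner ℂ (v i) (v j) = _
    simp only [v, inner_smul_left, inner_smul_right, hg, Subtype.mk.injEq]
    split_ifs with h
    · subst h
      have hi' : (s i : ℂ) ≠ 0 := by exact_mod_cast hi
      rw [← hs2]
      simp only [map_inv₀, Complex.conj_ofReal]
      push_cast
      field_simp
    · simp
  obtain ⟨b, hb⟩ := hv.exists_orthonormalBasis_extension_of_card_eq (by simp)
  let U : Matrix n n ℂ := of fun i j => b j i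
  have hU : U ∈ unitaryGroup n ℂ := by
    rw [mem_unitaryGroup_iff']
    ext i j
    have := orthonormal_iff_ite.1 b.orthonormal i j
    rw [star_eq_conjTranspose, mul_apply, one_apply, ← this]
    simp [U, PiLp.inner_apply, mul_comm]
  have hUG : U * diagonal (fun i => (s i : ℂ)) = G := by
    ext i j
    rw [mul_diagonal]
    by_cases hj : s j = 0
    · have h0 : g j = 0 := by
        rw [← inner_self_eq_zero (𝕜 := ℂ), hg, if_pos rfl, ← hs2, hj]; simp
      have : G i j = 0 := congrFun (congrArg WithLp.ofLp h0) i
      simp [hj, this]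
    · have hj' : (s j : ℂ) ≠ 0 := by exact_mod_cast hj
      simp only [U, of_apply, hb j hj, v, g, PiLp.smul_apply, smul_eq_mul]
      field_simp
  refine ⟨U, hU, Wᴴ, ?_, s, fun i => Real.sqrt_nonneg _, ?_⟩
  · exact Unitary.star_mem hWm
  · rw [hUG, hG, mul_assoc, hWW, mul_one]

end SingularValues

/-! ### Interpolation by the three lines theorem -/

/-- The complex power `x ^ z` of a nonnegative real, with `0 ^ z = 0` for every `z` (including
`z = 0`), so that it is an entire function of `z` for every `x`. -/
noncomputable def entirePow (x : ℝ) (z : ℂ) : ℂ := if x = 0 then 0 else (x : ℂ) ^ z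

theorem differentiable_entirePow (x : ℝ) : Differentiable ℂ (entirePow x) := by
  unfold entirePow
  split_ifs with h
  · exact differentiable_const _
  · intro z
    exact differentiableAt_id.const_cpow (Or.inl (by exact_mod_cast h))

theorem norm_entirePow_le {x : ℝ} (hx : 0 ≤ x) (z : ℂ) : ‖entirePow x z‖ ≤ x ^ z.re := by
  unfold entirePow
  split_ifs with h
  · simpa using Real.rpow_nonneg hx _
  · rw [Complex.norm_cpow_eq_rpow_re_of_pos (lt_of_le_of_ne hx (Ne.symm h))]

theorem entirePow_ofReal {x s : ℝ} (hx : 0 ≤ x) (hs : s ≠ 0) :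
    entirePow x s = ((x ^ s : ℝ) : ℂ) := by
  unfold entirePow
  split_ifs with h
  · simp [h, Real.zero_rpow hs]
  · rw [Complex.ofReal_cpow hx]

section Interpolation

open scoped Matrix.Norms.L2Operator

variable {n a : Type*} [Fintype n] [DecidableEq n] [Fintype a] [DecidableEq a]

omit [DecidableEq n] in
theorem norm_dotProduct_mulVec_le (K : Matrix n a ℂ) (u : n → ℂ) (v : a → ℂ) :
    ‖u ⬝ᵥ (K *ᵥ v)‖ ≤ ‖K‖ * (√(∑ i, ‖u i‖ ^ 2) * √(∑ i, ‖v i‖ ^ 2)) := by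
  have h1 : u ⬝ᵥ (K *ᵥ v)
      = inner ℂ (WithLp.toLp 2 (star u) : EuclideanSpace ℂ n) (WithLp.toLp 2 (K *ᵥ v)) := by
    simp [PiLp.inner_apply, dotProduct, mul_comm]
  have h2 := l2_opNorm_mulVec K (WithLp.toLp 2 v)
  have h3 : ‖(WithLp.toLp 2 (star u) : EuclideanSpace ℂ n)‖ = √(∑ i, ‖u i‖ ^ 2) := by
    simp [EuclideanSpace.norm_eq]
  have h4 : ‖(WithLp.toLp 2 v : EuclideanSpace ℂ a)‖ = √(∑ i, ‖v i‖ ^ 2) := by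
    simp [EuclideanSpace.norm_eq]
  rw [h1]
  refine (norm_inner_le_norm _ _).trans ?_
  rw [h3, ← h4]
  calc _ ≤ √(∑ i, ‖u i‖ ^ 2) * (‖K‖ * ‖(WithLp.toLp 2 v : EuclideanSpace ℂ a)‖) := by
        gcongr
        simpa using h2
    _ = _ := by ring

theorem norm_entry_le_l2_opNorm (K : Matrix n a ℂ) (i : n) (j : a) : ‖K i j‖ ≤ ‖K‖ := by
  have := norm_dotProduct_mulVec_le K (Pi.single i 1) (Pi.single j 1)
  simpa [Pi.single_apply, apply_ite] using this

theorem norm_trace_diagonal_mul_le (x : n → ℂ) (N : Matrix n n ℂ) :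
    ‖(diagonal x * N).trace‖ ≤ (∑ i, ‖x i‖) * ‖N‖ := by
  simp only [trace, diag_apply, diagonal_mul, Finset.sum_mul]
  refine (norm_sum_le _ _).trans (Finset.sum_le_sum fun i _ => ?_)
  rw [norm_mul]
  gcongr
  exact norm_entry_le_l2_opNorm N i i

theorem l2_opNorm_diagonal_le {x : n → ℂ} {c : ℝ} (hc : 0 ≤ c) (h : ∀ i, ‖x i‖ ≤ c) :
    ‖(diagonal x : Matrix n n ℂ)‖ ≤ c := by
  rw [l2_opNorm_diagonal]
  exact (pi_norm_le_iff_of_nonneg hc).2 h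

omit [DecidableEq n] in
theorem l2_opNorm_mul_le_of_le {l : Type*} [Fintype l] [DecidableEq l]
    {M : Matrix n a ℂ} {N : Matrix a l ℂ} {x y : ℝ}
    (hM : ‖M‖ ≤ x) (hN : ‖N‖ ≤ y) : ‖M * N‖ ≤ x * y :=
  (l2_opNorm_mul M N).trans (mul_le_mul hM hN (norm_nonneg _) ((norm_nonneg _).trans hM))

omit [Fintype n] [DecidableEq n] [DecidableEq a] in
theorem differentiable_matrix_mul {l : Type*} {M : ℂ → Matrix n a ℂ} {N : ℂ → Matrix a l ℂ}
    (hM : ∀ i j, Differentiable ℂ fun z => M z i j) (hN : ∀ i j, Differentiable ℂ fun z => N z i j)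
    (i : n) (j : l) : Differentiable ℂ fun z => (M z * N z) i j := by
  simp only [mul_apply]
  exact Differentiable.fun_sum fun k _ => (hM i k).mul (hN k j)

omit [Fintype n] in
theorem differentiable_diagonal {x : ℂ → n → ℂ} (hx : ∀ i, Differentiable ℂ fun z => x z i)
    (i j : n) : Differentiable ℂ fun z => (diagonal (x z) : Matrix n n ℂ) i j := by
  simp only [diagonal_apply]
  split_ifs
  · exact hx i
  · exact differentiable_const _

theorem rpow_le_max_one {x t : ℝ} (hx : 0 ≤ x) (h0 : 0 ≤ t) (h1 : t ≤ 1) :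
    x ^ t ≤ max 1 x := by
  rcases le_total x 1 with h | h
  · exact (Real.rpow_le_one hx h h0).trans (le_max_left _ _)
  · calc x ^ t ≤ x ^ (1 : ℝ) := Real.rpow_le_rpow_of_exponent_le h h1
      _ = x := Real.rpow_one x
      _ ≤ _ := le_max_right _ _

/-- On the line `Re z = 1` of the interpolation argument, the weight `b` on the index set `a` acts
as a trace-class operator, because each of its atoms is sandwiched between two vectors. -/
theorem norm_trace_weighted_le {K : Matrix n n ℂ} (hK : ‖K‖ ≤ 1)
    {x : a → ℂ} {b : a → ℝ} (hx : ∀ i, ‖x i‖ ≤ b i) {P : Matrix n a ℂ} {Q : Matrix a n ℂ} {τ : ℝ}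
    (hP : ∑ j, b j * ∑ i, ‖P i j‖ ^ 2 ≤ τ) (hQ : ∑ j, b j * ∑ i, ‖Q j i‖ ^ 2 ≤ τ) :
    ‖(diagonal x * (Q * K * P)).trace‖ ≤ τ := by
  have hentry : ∀ j, (Q * K * P) j j = Q j ⬝ᵥ (K *ᵥ fun i => P i j) := by
    intro j
    rw [Matrix.mul_assoc, mul_apply]
    rfl
  calc ‖(diagonal x * (Q * K * P)).trace‖
      ≤ ∑ j, ‖x j * (Q * K * P) j j‖ := by
        simp only [trace, diag_apply, diagonal_mul]
        exact norm_sum_le _ _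
    _ ≤ ∑ j, (b j * ∑ i, ‖P i j‖ ^ 2 + b j * ∑ i, ‖Q j i‖ ^ 2) / 2 := by
        refine Finset.sum_le_sum fun j _ => ?_
        rw [norm_mul, hentry]
        have h1 := norm_dotProduct_mulVec_le K (Q j) (fun i => P i j)
        set u := √(∑ i, ‖Q j i‖ ^ 2)
        set v := √(∑ i, ‖P i j‖ ^ 2)
        have hu : u ^ 2 = ∑ i, ‖Q j i‖ ^ 2 := Real.sq_sqrt (by positivity)
        have hv : v ^ 2 = ∑ i, ‖P i j‖ ^ 2 := Real.sq_sqrt (by positivity)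
        have hb : 0 ≤ b j := (norm_nonneg _).trans (hx j)
        have h2 : ‖Q j ⬝ᵥ (K *ᵥ fun i => P i j)‖ ≤ u * v :=
          h1.trans (mul_le_of_le_one_left (by positivity) hK)
        rw [← hu, ← hv]
        calc _ ≤ b j * (u * v) := mul_le_mul (hx j) h2 (norm_nonneg _) hb
          _ ≤ _ := by nlinarith [mul_nonneg hb (sq_nonneg (u - v))]
    _ ≤ τ := by
        rw [← Finset.sum_div, Finset.sum_add_distrib]
        linarith

/-- The interpolation inequality behind the Lieb–Thirring type bounds for Schatten norms. It comes
from the three lines theorem, applied to the function of `z` that has `1 - z`, `z / 2`, `z` and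
`z / 2` in place of the four exponents. -/
theorem norm_trace_interpolation_le {c d : n → ℝ} {b : a → ℝ} {Y W : Matrix n n ℂ}
    {A : Matrix n a ℂ} {B : Matrix a n ℂ} {s τ : ℝ} (hs0 : 0 < s) (hs1 : s < 1)
    (hc : ∀ i, 0 ≤ c i) (hc1 : ∑ i, c i ≤ 1) (hd : ∀ i, 0 < d i)
    (hb : ∀ j, 0 ≤ b j) (hb1 : ∀ j, b j ≤ 1) (hY : ‖Y‖ ≤ 1) (hW : ‖W‖ ≤ 1)
    (hA : ‖A‖ ≤ 1) (hB : ‖B‖ ≤ 1)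
    (hτA : ∑ j, b j * ∑ i, d i * ‖A i j‖ ^ 2 ≤ τ) (hτB : ∑ j, b j * ∑ i, d i * ‖B j i‖ ^ 2 ≤ τ) :
    ‖(diagonal (fun i => ((c i ^ (1 - s) : ℝ) : ℂ)) *
      (Y * (diagonal (fun i => ((d i ^ (s / 2) : ℝ) : ℂ)) *
        (A * (diagonal (fun j => ((b j ^ s : ℝ) : ℂ)) *
          (B * (diagonal (fun i => ((d i ^ (s / 2) : ℝ) : ℂ)) * W))))))).trace‖ ≤ τ ^ s := by
  let C : ℂ → Matrix n n ℂ := fun z => diagonal fun i => entirePow (c i) (1 - z)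
  let D : ℂ → Matrix n n ℂ := fun z => diagonal fun i => entirePow (d i) (z / 2)
  let E : ℂ → Matrix a a ℂ := fun z => diagonal fun j => entirePow (b j) z
  let f : ℂ → ℂ := fun z => (C z * (Y * (D z * (A * (E z * (B * (D z * W))))))).trace
  have hfs : f s = (diagonal (fun i => ((c i ^ (1 - s) : ℝ) : ℂ)) *
      (Y * (diagonal (fun i => ((d i ^ (s / 2) : ℝ) : ℂ)) *
        (A * (diagonal (fun j => ((b j ^ s : ℝ) : ℂ)) *
          (B * (diagonal (fun i => ((d i ^ (s / 2) : ℝ) : ℂ)) * W))))))).trace := by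
    have e1 : ∀ i, entirePow (c i) (1 - (s : ℂ)) = ((c i ^ (1 - s) : ℝ) : ℂ) := fun i => by
      rw [← entirePow_ofReal (hc i) (by linarith)]; push_cast; rfl
    have e2 : ∀ i, entirePow (d i) ((s : ℂ) / 2) = ((d i ^ (s / 2) : ℝ) : ℂ) := fun i => by
      rw [← entirePow_ofReal (hd i).le (by linarith)]; push_cast; rfl
    have e3 : ∀ j, entirePow (b j) (s : ℂ) = ((b j ^ s : ℝ) : ℂ) := fun j =>
      entirePow_ofReal (hb j) hs0.ne'
    simp only [f, C, D, E, e1, e2, e3]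
  have hdiff : Differentiable ℂ f := by
    have hC : ∀ i j, Differentiable ℂ fun z => C z i j := differentiable_diagonal fun i =>
      (differentiable_entirePow _).comp ((differentiable_const 1).sub differentiable_id)
    have hD : ∀ i j, Differentiable ℂ fun z => D z i j := differentiable_diagonal fun i =>
      (differentiable_entirePow _).comp (differentiable_id.div_const 2)
    have hE : ∀ i j, Differentiable ℂ fun z => E z i j := differentiable_diagonal fun i =>
      differentiable_entirePow _
    have key : ∀ i j, Differentiable ℂ fun z =>
        (C z * (Y * (D z * (A * (E z * (B * (D z * W))))))) i j := by
      clear_value C D E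
      exact differentiable_matrix_mul hC (differentiable_matrix_mul (fun _ _ => by fun_prop)
        (differentiable_matrix_mul hD (differentiable_matrix_mul (fun _ _ => by fun_prop)
        (differentiable_matrix_mul hE (differentiable_matrix_mul (fun _ _ => by fun_prop)
        (differentiable_matrix_mul hD (fun _ _ => by fun_prop)))))))
    exact Differentiable.fun_sum fun i _ => key i i
  have hEle : ∀ z : ℂ, 0 ≤ z.re → ‖E z‖ ≤ 1 := fun z hz =>
    l2_opNorm_diagonal_le zero_le_one fun j => (norm_entirePow_le (hb j) z).trans
      (Real.rpow_le_one (hb j) (hb1 j) hz)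
  have hci : ∀ i, c i ≤ 1 := fun i =>
    (Finset.single_le_sum (fun j _ => hc j) (Finset.mem_univ i)).trans hc1
  -- the product of all factors after the first is bounded in terms of `D`
  have hprod : ∀ z : ℂ, ∀ δ, 0 ≤ z.re → ‖D z‖ ≤ δ →
      ‖Y * (D z * (A * (E z * (B * (D z * W)))))‖ ≤ δ * δ := by
    intro z δ hz hδ
    have := l2_opNorm_mul_le_of_le hY (l2_opNorm_mul_le_of_le hδ (l2_opNorm_mul_le_of_le hA
      (l2_opNorm_mul_le_of_le (hEle z hz) (l2_opNorm_mul_le_of_le hB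
        (l2_opNorm_mul_le_of_le hδ hW)))))
    simpa using this
  have hbound : BddAbove ((norm ∘ f) '' Complex.HadamardThreeLines.verticalClosedStrip 0 1) := by
    obtain ⟨δ, hδ0, hδ⟩ : ∃ δ : ℝ, 0 ≤ δ ∧ ∀ i, max 1 (d i) ≤ δ :=
      ⟨∑ i, max 1 (d i), Finset.sum_nonneg fun i _ => by positivity, fun i =>
        Finset.single_le_sum (f := fun i => max 1 (d i)) (fun j _ => by positivity)
          (Finset.mem_univ i)⟩
    refine ⟨(∑ _i : n, (1 : ℝ)) * (δ * δ), ?_⟩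
    rintro _ ⟨z, ⟨hz0, hz1⟩, rfl⟩
    refine (norm_trace_diagonal_mul_le _ _).trans ?_
    refine mul_le_mul (Finset.sum_le_sum fun i _ => ?_) (hprod z δ hz0 ?_) (norm_nonneg _)
      (by positivity)
    · refine (norm_entirePow_le (hc i) _).trans (Real.rpow_le_one (hc i) (hci i) ?_)
      simpa using hz1
    · refine l2_opNorm_diagonal_le hδ0 fun i => (norm_entirePow_le (hd i).le _).trans
        ((rpow_le_max_one (hd i).le ?_ ?_).trans (hδ i))
      · have : (z / 2).re = z.re / 2 := by simp
        rw [this]; linarith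
      · have : (z / 2).re = z.re / 2 := by simp
        rw [this]; linarith
  have h0 : ∀ z ∈ Complex.re ⁻¹' {0}, ‖f z‖ ≤ 1 := by
    intro z hz
    have hz : z.re = 0 := hz
    refine (norm_trace_diagonal_mul_le _ _).trans ?_
    have h1 : ∑ i, ‖entirePow (c i) (1 - z)‖ ≤ 1 := by
      refine le_trans (Finset.sum_le_sum fun i _ => ?_) hc1
      simpa [hz] using norm_entirePow_le (hc i) (1 - z)
    have h2 := hprod z 1 hz.ge (l2_opNorm_diagonal_le zero_le_one fun i => by
      simpa [hz] using norm_entirePow_le (hd i).le (z / 2))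
    exact mul_le_one₀ h1 (norm_nonneg _) (by simpa using h2)
  have h1 : ∀ z ∈ Complex.re ⁻¹' {1}, ‖f z‖ ≤ τ := by
    intro z hz
    have hz : z.re = 1 := hz
    have hcyc : f z = (E z * ((B * D z) * (W * (C z * Y)) * (D z * A))).trace := by
      simp only [f]
      rw [show C z * (Y * (D z * (A * (E z * (B * (D z * W))))))
        = (C z * Y * D z * A) * (E z * (B * D z) * W) by
          simp only [Matrix.mul_assoc], trace_mul_comm]
      simp only [Matrix.mul_assoc]
    have hCn : ‖C z‖ ≤ 1 := l2_opNorm_diagonal_le zero_le_one fun i => by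
      simpa [hz] using norm_entirePow_le (hc i) (1 - z)
    have hK : ‖W * (C z * Y)‖ ≤ 1 := by
      simpa using l2_opNorm_mul_le_of_le hW (l2_opNorm_mul_le_of_le hCn hY)
    have hD2 : ∀ i, ‖entirePow (d i) (z / 2)‖ ^ 2 ≤ d i := by
      intro i
      have h := norm_entirePow_le (hd i).le (z / 2)
      have : (z / 2).re = 1 / 2 := by simp [hz]
      rw [this, ← Real.sqrt_eq_rpow] at h
      calc _ ≤ √(d i) ^ 2 := by gcongr
        _ = d i := Real.sq_sqrt (hd i).le
    rw [hcyc]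
    refine norm_trace_weighted_le hK (b := b) (fun j => ?_) (le_trans ?_ hτA) (le_trans ?_ hτB)
    · simpa [hz] using norm_entirePow_le (hb j) z
    · refine Finset.sum_le_sum fun j _ => mul_le_mul_of_nonneg_left
        (Finset.sum_le_sum fun i _ => ?_) (hb j)
      rw [diagonal_mul, norm_mul, mul_pow]
      gcongr
      exact hD2 i
    · refine Finset.sum_le_sum fun j _ => mul_le_mul_of_nonneg_left
        (Finset.sum_le_sum fun i _ => ?_) (hb j)
      rw [mul_diagonal, norm_mul, mul_pow, mul_comm]
      gcongr
      exact hD2 i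
  have := Complex.HadamardThreeLines.norm_le_interp_of_mem_verticalClosedStrip₀₁' f (z := s)
    ⟨by simpa using hs0.le, by simpa using hs1.le⟩ hdiff.diffContOnCl hbound h0 h1
  rw [hfs] at this
  simpa using this

end Interpolation

/-! ### Sums of Kronecker products with positive semidefinite factors -/

section SchattenBasic

variable {n : Type*} [Fintype n] [DecidableEq n]

theorem schattenNorm_nonneg (p : ℝ) (A : Matrix n n ℂ) : 0 ≤ schattenNorm p A := by
  obtain ⟨U, hU, V, hV, s, hs, rfl⟩ := exists_svd A
  rw [schattenNorm_svd p hU hs hV]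
  exact Real.rpow_nonneg (Finset.sum_nonneg fun i _ => Real.rpow_nonneg (hs i) _) _

theorem schattenNorm_zero {p : ℝ} (hp : 0 < p) : schattenNorm p (0 : Matrix n n ℂ) = 0 := by
  have := schattenNorm_svd p (U := (1 : Matrix n n ℂ)) (one_mem _) (s := fun _ => 0)
    (fun _ => le_rfl) (V := (1 : Matrix n n ℂ)) (one_mem _)
  simpa [Real.zero_rpow hp.ne', Real.zero_rpow (inv_pos.2 hp).ne'] using this

theorem eq_zero_of_schattenNorm_eq_zero {p : ℝ} (hp : 0 < p) {A : Matrix n n ℂ}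
    (h : schattenNorm p A = 0) : A = 0 := by
  obtain ⟨U, hU, V, hV, s, hs, rfl⟩ := exists_svd A
  rw [schattenNorm_svd p hU hs hV] at h
  have hnn : ∀ i, 0 ≤ s i ^ p := fun i => Real.rpow_nonneg (hs i) _
  rw [Real.rpow_eq_zero (Finset.sum_nonneg fun i _ => hnn i) (by positivity),
    Finset.sum_eq_zero_iff_of_nonneg fun i _ => hnn i] at h
  have hs0 : ∀ i, s i = 0 := fun i => by
    have := h i (Finset.mem_univ i)
    rwa [Real.rpow_eq_zero (hs i) hp.ne'] at this
  simp [hs0]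

theorem schattenNorm_smul {p : ℝ} (hp : 0 < p) {c : ℝ} (hc : 0 ≤ c) (A : Matrix n n ℂ) :
    schattenNorm p ((c : ℂ) • A) = c * schattenNorm p A := by
  obtain ⟨U, hU, V, hV, s, hs, rfl⟩ := exists_svd A
  have h : (c : ℂ) • (U * diagonal (fun i => (s i : ℂ)) * V)
      = U * diagonal (fun i => ((c * s i : ℝ) : ℂ)) * V := by
    have : diagonal (fun i => ((c * s i : ℝ) : ℂ)) = (c : ℂ) • diagonal (fun i => (s i : ℂ)) := by
      rw [← diagonal_smul]; congr 1; ext i; simp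
    rw [this]; simp
  rw [h, schattenNorm_svd p hU hs hV, schattenNorm_svd p hU (fun i => mul_nonneg hc (hs i)) hV]
  have : ∑ i, (c * s i) ^ p = c ^ p * ∑ i, s i ^ p := by
    rw [Finset.mul_sum]
    exact Finset.sum_congr rfl fun i _ => Real.mul_rpow hc (hs i)
  rw [this, Real.mul_rpow (Real.rpow_nonneg hc _)
    (Finset.sum_nonneg fun i _ => Real.rpow_nonneg (hs i) _), ← Real.rpow_mul hc,
    mul_one_div_cancel hp.ne', Real.rpow_one]

/-- The Schatten norm is attained in the trace pairing; the optimal `c` is proportional to the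
`q`-th powers of the singular values of `G`. -/
theorem schattenNorm_le_of_norm_trace_le {q x : ℝ} (hq : 1 < q) {G : Matrix n n ℂ}
    (h : ∀ Y ∈ unitaryGroup n ℂ, ∀ W ∈ unitaryGroup n ℂ, ∀ c : n → ℝ, (∀ i, 0 ≤ c i) →
      ∑ i, c i ≤ 1 →
      ‖(diagonal (fun i => ((c i ^ (1 - 1 / q) : ℝ) : ℂ)) * (Y * G * W)).trace‖ ≤ x) :
    schattenNorm q G ≤ x := by
  have hq0 : 0 < q := by linarith
  obtain ⟨U, hU, V, hV, s, hs, rfl⟩ := exists_svd G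
  rw [schattenNorm_svd q hU hs hV]
  set S := ∑ i, s i ^ q with hS
  have hnn : ∀ i, 0 ≤ s i ^ q := fun i => Real.rpow_nonneg (hs i) _
  have hS0 : 0 ≤ S := Finset.sum_nonneg fun i _ => hnn i
  have hY : Uᴴ ∈ unitaryGroup n ℂ := Unitary.star_mem hU
  have hW : Vᴴ ∈ unitaryGroup n ℂ := Unitary.star_mem hV
  rcases hS0.eq_or_lt with hz | hpos
  · rw [← hz, Real.zero_rpow (by positivity)]
    exact (norm_nonneg _).trans (h _ hY _ hW 0 (fun _ => le_rfl) (by simp))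
  · have := h _ hY _ hW (fun i => s i ^ q / S) (fun i => div_nonneg (hnn i) hS0)
      (by rw [← Finset.sum_div, ← hS, div_self hpos.ne'])
    have hmid : Uᴴ * (U * diagonal (fun i => (s i : ℂ)) * V) * Vᴴ
        = diagonal (fun i => (s i : ℂ)) := by
      have hVV : V * Vᴴ = 1 := mem_unitaryGroup_iff.1 hV
      have hUU : Uᴴ * U = 1 := mem_unitaryGroup_iff'.1 hU
      calc _ = (Uᴴ * U) * diagonal (fun i => (s i : ℂ)) * (V * Vᴴ) := by
            simp only [Matrix.mul_assoc]
        _ = _ := by rw [hVV, hUU]; simp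
    rw [hmid, diagonal_mul_diagonal, trace_diagonal] at this
    refine le_trans (le_of_eq ?_) this
    have hterm : ∀ i, (((s i ^ q / S) ^ (1 - 1 / q) : ℝ) : ℂ) * (s i : ℂ)
        = ((s i ^ q / S ^ (1 - 1 / q) : ℝ) : ℂ) := by
      intro i
      rw [← Complex.ofReal_mul]
      congr 1
      rw [Real.div_rpow (hnn i) hS0, ← Real.rpow_mul (hs i)]
      rcases (hs i).eq_or_lt with h0 | h0
      · rw [← h0, Real.zero_rpow hq0.ne']; simp
      · have e : q * (1 - 1 / q) = q - 1 := by field_simp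
        rw [e, div_mul_eq_mul_div, Real.rpow_sub_one h0.ne', div_mul_cancel₀ _ h0.ne']
    simp only [hterm]
    rw [← Complex.ofReal_sum, ← Finset.sum_div, ← hS, Complex.norm_real, Real.norm_of_nonneg
      (div_nonneg hS0 (Real.rpow_nonneg hS0 _)), Real.rpow_sub hpos, Real.rpow_one]
    field_simp

end SchattenBasic

section Stacking

variable {κ l n : Type*} [Fintype κ] [Fintype l]

/-- The matrices `M k` stacked on top of one another. -/
def stack (M : κ → Matrix l n ℂ) : Matrix (κ × l) n ℂ := of fun x y => M x.1 x.2 y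

theorem conjTranspose_stack_mul_diagonal_mul_stack [DecidableEq κ] [DecidableEq l]
    (M M' : κ → Matrix l n ℂ) (w : κ × l → ℂ) :
    (stack M)ᴴ * (diagonal w * stack M')
      = ∑ k, (M k)ᴴ * (diagonal (fun j => w (k, j)) * M' k) := by
  ext i j
  rw [Matrix.mul_apply, Matrix.sum_apply, Fintype.sum_prod_type]
  simp only [Matrix.mul_apply (M := (M _)ᴴ), diagonal_mul]
  rfl

theorem conjTranspose_stack_mul_stack [DecidableEq κ] [DecidableEq l] (M M' : κ → Matrix l n ℂ) :
    (stack M)ᴴ * stack M' = ∑ k, (M k)ᴴ * M' k := by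
  have := conjTranspose_stack_mul_diagonal_mul_stack M M' 1
  simpa using this

end Stacking

section Key

open scoped Matrix.Norms.L2Operator

variable {κ n m : Type*} [Fintype κ] [DecidableEq κ] [Fintype n] [DecidableEq n]
  [Fintype m] [DecidableEq m]

theorem l2_opNorm_unitary_le {U : Matrix n n ℂ} (hU : U ∈ unitaryGroup n ℂ) : ‖U‖ ≤ 1 := by
  have h := l2_opNorm_conjTranspose_mul_self U
  rw [show Uᴴ * U = 1 from mem_unitaryGroup_iff'.1 hU, ← diagonal_one] at h
  have h1 : ‖(diagonal (fun _ => 1) : Matrix n n ℂ)‖ ≤ 1 :=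
    l2_opNorm_diagonal_le zero_le_one fun i => by simp
  nlinarith [norm_nonneg U]

theorem kronecker_mem_unitaryGroup {U : Matrix n n ℂ} {V : Matrix m m ℂ}
    (hU : U ∈ unitaryGroup n ℂ) (hV : V ∈ unitaryGroup m ℂ) :
    U ⊗ₖ V ∈ unitaryGroup (n × m) ℂ := by
  rw [mem_unitaryGroup_iff, star_eq_conjTranspose, conjTranspose_kronecker, ← mul_kronecker_mul,
    show U * Uᴴ = 1 from mem_unitaryGroup_iff.1 hU, show V * Vᴴ = 1 from mem_unitaryGroup_iff.1 hV,
    one_kronecker_one]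

variable {P : κ → Matrix n n ℂ} {V : κ → Matrix m m ℂ} {r : n → ℝ}

/-- The stacked matrix `C` satisfies `Cᴴ C = (∑ (P k)ᴴ P k) ⊗ 1`, and this is at most `1`. -/
theorem l2_opNorm_stack_kronecker_le (hP : ∑ k, (P k)ᴴ * P k = diagonal (fun i => (r i : ℂ)))
    (hr0 : ∀ i, 0 ≤ r i) (hr1 : ∀ i, r i ≤ 1) (hV : ∀ k, V k ∈ unitaryGroup m ℂ) :
    ‖stack fun k => P k ⊗ₖ V k‖ ≤ 1 := by
  have h := l2_opNorm_conjTranspose_mul_self (stack fun k => P k ⊗ₖ V k)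
  have hsum : ∑ k, (P k ⊗ₖ V k)ᴴ * (P k ⊗ₖ V k) = diagonal (fun x : n × m => (r x.1 : ℂ)) := by
    have : ∀ k, (P k ⊗ₖ V k)ᴴ * (P k ⊗ₖ V k) = ((P k)ᴴ * P k) ⊗ₖ (1 : Matrix m m ℂ) := fun k => by
      rw [conjTranspose_kronecker, ← mul_kronecker_mul,
        show (V k)ᴴ * V k = 1 from mem_unitaryGroup_iff'.1 (hV k)]
    simp only [this]
    ext x y
    have := congrFun (congrFun hP x.1) y.1
    rw [Matrix.sum_apply] at this ⊢
    simp only [kroneckerMap_apply]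
    rw [← Finset.sum_mul, this]
    simp only [diagonal_apply, one_apply, Prod.ext_iff]
    split_ifs <;> simp_all
  rw [conjTranspose_stack_mul_stack, hsum] at h
  have h1 : ‖(diagonal (fun x : n × m => (r x.1 : ℂ)))‖ ≤ 1 :=
    l2_opNorm_diagonal_le zero_le_one fun x => by
      rw [Complex.norm_real, Real.norm_of_nonneg (hr0 _)]; exact hr1 _
  nlinarith [norm_nonneg (stack fun k => P k ⊗ₖ V k)]

omit [DecidableEq κ] in
/-- The trace bound for the stacked matrix that `norm_trace_interpolation_le` asks for: the weights
`b` are summed out first, and then `∑ (P k)ᴴ P k ≤ 1` is used. -/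
theorem sum_weighted_stack_kronecker_le (hP : ∑ k, (P k)ᴴ * P k = diagonal (fun i => (r i : ℂ)))
    (hr1 : ∀ i, r i ≤ 1) (hV : ∀ k, V k ∈ unitaryGroup m ℂ)
    {b : κ → m → ℝ} (hb1 : ∀ k, ∑ j, b k j ≤ 1) {d : n → ℝ} (hd : ∀ i, 0 ≤ d i) :
    ∑ x : κ × n × m, b x.1 x.2.2 *
      ∑ y : n × m, d y.1 * ‖stack (fun k => P k ⊗ₖ V k) x y‖ ^ 2 ≤ ∑ i, d i := by
  have hrow : ∀ k j, ∑ a, ‖V k j a‖ ^ 2 = 1 := by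
    intro k j
    have := congrFun (congrFun (mem_unitaryGroup_iff.1 (hV k)) j) j
    rw [star_eq_conjTranspose, mul_apply, one_apply_eq] at this
    simp only [conjTranspose_apply, ← starRingEnd_apply, Complex.mul_conj,
      Complex.normSq_eq_norm_sq] at this
    exact_mod_cast this
  have hcol : ∀ i, ∑ k, ∑ l, ‖P k l i‖ ^ 2 = r i := by
    intro i
    have := congrFun (congrFun hP i) i
    rw [Matrix.sum_apply, diagonal_apply_eq] at this
    simp only [mul_apply, conjTranspose_apply, ← starRingEnd_apply, mul_comm, Complex.mul_conj,
      Complex.normSq_eq_norm_sq] at this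
    exact_mod_cast this
  have hinner : ∀ x : κ × n × m, ∑ y : n × m, d y.1 * ‖stack (fun k => P k ⊗ₖ V k) x y‖ ^ 2
      = ∑ i, d i * ‖P x.1 x.2.1 i‖ ^ 2 := by
    intro x
    rw [Fintype.sum_prod_type]
    refine Finset.sum_congr rfl fun i _ => ?_
    simp only [stack, of_apply, kroneckerMap_apply, norm_mul, mul_pow, ← mul_assoc]
    rw [← Finset.mul_sum, hrow, mul_one]
  simp only [hinner, Fintype.sum_prod_type]
  calc ∑ k, ∑ l, ∑ j, b k j * ∑ i, d i * ‖P k l i‖ ^ 2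
      ≤ ∑ k, ∑ l, ∑ i, d i * ‖P k l i‖ ^ 2 := by
        refine Finset.sum_le_sum fun k _ => Finset.sum_le_sum fun l _ => ?_
        rw [← Finset.sum_mul]
        refine mul_le_of_le_one_left (Finset.sum_nonneg fun i _ => ?_) (hb1 k)
        exact mul_nonneg (hd i) (by positivity)
    _ = ∑ i, d i * r i := by
        have h1 : ∀ k, ∑ l, ∑ i, d i * ‖P k l i‖ ^ 2 = ∑ i, ∑ l, d i * ‖P k l i‖ ^ 2 :=
          fun k => Finset.sum_comm
        simp only [h1]
        rw [Finset.sum_comm]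
        simp only [← Finset.mul_sum, hcol]
    _ ≤ ∑ i, d i := Finset.sum_le_sum fun i _ => mul_le_of_le_one_right (hd i) (hr1 i)

/-- The case of `schattenNorm_sum_kronecker_le` in which the `B k` lie in the unit ball and `∑ R k`
is dominated by an invertible matrix, with the eigenvalues `d i`. -/
theorem schattenNorm_sum_kronecker_le_of_lt {q : ℝ} (hq : 1 < q) {R : κ → Matrix n n ℂ}
    (hR : ∀ k, (R k).PosSemidef) {B : κ → Matrix m m ℂ} (hB : ∀ k, schattenNorm q (B k) ≤ 1)
    {U : Matrix n n ℂ} (hU : U ∈ unitaryGroup n ℂ) {t d : n → ℝ} (ht : ∀ i, 0 ≤ t i)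
    (hsum : ∑ k, R k = U * diagonal (fun i => (t i : ℂ)) * Uᴴ) (hd : ∀ i, t i < d i) :
    schattenNorm q (∑ k, R k ⊗ₖ B k) ≤ (∑ i, d i ^ q) ^ (1 / q) := by
  have hq0 : 0 < q := by linarith
  have hd0 : ∀ i, 0 < d i := fun i => (ht i).trans_lt (hd i)
  choose F hF V hV s hs hBs using fun k => exists_svd (B k)
  have hs1 : ∀ k, ∑ j, s k j ^ q ≤ 1 := by
    intro k
    have h := hB k
    rw [hBs k, schattenNorm_svd q (hF k) (hs k) (hV k)] at h
    by_contra! hlt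
    exact absurd h (not_le.2 (Real.one_lt_rpow hlt (by positivity)))
  choose S hS using fun k => CStarAlgebra.nonneg_iff_eq_star_mul_self.1
    (nonneg_iff_posSemidef.2 (hR k))
  have hUU : Uᴴ * U = 1 := mem_unitaryGroup_iff'.1 hU
  have hUU' : U * Uᴴ = 1 := mem_unitaryGroup_iff.1 hU
  let Δ : Matrix n n ℂ := diagonal fun i => ((√(d i) : ℝ) : ℂ)
  let Δi : Matrix n n ℂ := diagonal fun i => (((√(d i))⁻¹ : ℝ) : ℂ)
  have hsq : ∀ i, (√(d i) : ℝ) ≠ 0 := fun i => (Real.sqrt_pos.2 (hd0 i)).ne'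
  have hΔ : Δi * Δ = 1 := by
    simp only [Δ, Δi, diagonal_mul_diagonal, ← Complex.ofReal_mul]
    rw [← diagonal_one]; congr 1; ext i
    rw [inv_mul_cancel₀ (hsq i)]; simp
  have hΔi : Δiᴴ = Δi := by
    simp only [Δi, diagonal_conjTranspose]; congr 1; ext i; simp
  have hΔs : Δᴴ = Δ := by
    simp only [Δ, diagonal_conjTranspose]; congr 1; ext i; simp
  let P : κ → Matrix n n ℂ := fun k => S k * U * Δi
  have hPS : ∀ k, P k * (Δ * Uᴴ) = S k := by
    intro k
    calc _ = S k * (U * ((Δi * Δ) * Uᴴ)) := by simp only [P, Matrix.mul_assoc]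
      _ = _ := by rw [hΔ, Matrix.one_mul, hUU', Matrix.mul_one]
  have hPP : ∑ k, (P k)ᴴ * P k = diagonal (fun i => ((t i / d i : ℝ) : ℂ)) := by
    have h1 : ∀ k, (P k)ᴴ * P k = Δi * (Uᴴ * R k * U) * Δi := fun k => by
      simp only [P, conjTranspose_mul, hΔi, hS k, star_eq_conjTranspose, Matrix.mul_assoc]
    simp only [h1]
    rw [← Matrix.sum_mul, ← Matrix.mul_sum, ← Matrix.sum_mul, ← Matrix.mul_sum, hsum]
    have h2 : Uᴴ * (U * diagonal (fun i => (t i : ℂ)) * Uᴴ) * U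
        = diagonal (fun i => (t i : ℂ)) := by
      calc _ = (Uᴴ * U) * diagonal (fun i => (t i : ℂ)) * (Uᴴ * U) := by
            simp only [Matrix.mul_assoc]
        _ = _ := by rw [hUU]; simp
    rw [h2]
    simp only [Δi, diagonal_mul_diagonal, ← Complex.ofReal_mul]
    congr 1; ext i
    congr 1
    have := Real.mul_self_sqrt (hd0 i).le
    have h0 := hsq i
    rw [← this]
    field_simp
    rw [Real.sqrt_sq (Real.sqrt_nonneg _)]
  have hr0 : ∀ i, 0 ≤ t i / d i := fun i => div_nonneg (ht i) (hd0 i).le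
  have hr1 : ∀ i, t i / d i ≤ 1 := fun i => (div_le_one (hd0 i)).2 (hd i).le
  have hFs : ∀ k, (F k)ᴴ ∈ unitaryGroup m ℂ := fun k => Unitary.star_mem (hF k)
  let β : κ × n × m → ℝ := fun x => s x.1 x.2.2
  let A := stack fun k => P k ⊗ₖ (F k)ᴴ
  let C := stack fun k => P k ⊗ₖ V k
  let Δ' : Matrix (n × m) (n × m) ℂ := diagonal fun x => ((√(d x.1) : ℝ) : ℂ)
  let U' : Matrix (n × m) (n × m) ℂ := U ⊗ₖ 1
  have hU' : U' ∈ unitaryGroup (n × m) ℂ := kronecker_mem_unitaryGroup hU (one_mem _)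
  have hΔ' : Δ' = Δ ⊗ₖ (1 : Matrix m m ℂ) := by
    simp only [Δ', Δ]
    rw [← diagonal_one, diagonal_kronecker_diagonal]
    simp
  have hfact : ∑ k, R k ⊗ₖ B k
      = U' * (Δ' * (Aᴴ * (diagonal (fun x => (β x : ℂ)) * (C * (Δ' * U'ᴴ))))) := by
    have hmid : Aᴴ * (diagonal (fun x => (β x : ℂ)) * C) = ∑ k, ((P k)ᴴ * P k) ⊗ₖ B k := by
      rw [conjTranspose_stack_mul_diagonal_mul_stack]
      refine Finset.sum_congr rfl fun k _ => ?_
      have : diagonal (fun j : n × m => (β (k, j) : ℂ))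
          = (1 : Matrix n n ℂ) ⊗ₖ diagonal (fun j => (s k j : ℂ)) := by
        rw [← diagonal_one, diagonal_kronecker_diagonal]
        simp [β]
      rw [this, conjTranspose_kronecker, conjTranspose_conjTranspose, ← mul_kronecker_mul,
        ← mul_kronecker_mul, Matrix.one_mul, hBs k, Matrix.mul_assoc (F k)]
    have : U' * (Δ' * (Aᴴ * (diagonal (fun x => (β x : ℂ)) * (C * (Δ' * U'ᴴ)))))
        = U' * Δ' * (Aᴴ * (diagonal (fun x => (β x : ℂ)) * C)) * (Δ' * U'ᴴ) := by
      simp only [Matrix.mul_assoc]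
    rw [this, hmid, Matrix.mul_sum, Matrix.sum_mul]
    refine Finset.sum_congr rfl fun k _ => ?_
    rw [hΔ', conjTranspose_kronecker, conjTranspose_one, ← mul_kronecker_mul, ← mul_kronecker_mul,
      ← mul_kronecker_mul, ← mul_kronecker_mul]
    simp only [Matrix.one_mul, Matrix.mul_one]
    congr 1
    calc R k = (P k * (Δ * Uᴴ))ᴴ * (P k * (Δ * Uᴴ)) := by rw [hPS, hS, star_eq_conjTranspose]
      _ = _ := by
        simp only [conjTranspose_mul, conjTranspose_conjTranspose, hΔs, Matrix.mul_assoc]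
  have hdq : ∀ i, 0 < d i ^ q := fun i => Real.rpow_pos_of_pos (hd0 i) _
  refine schattenNorm_le_of_norm_trace_le hq fun Y hY W hW c hc hc1 => ?_
  have hinterp := norm_trace_interpolation_le (s := 1 / q) (c := c)
    (d := fun x : n × m => d x.1 ^ q)
    (b := fun x => β x ^ q) (Y := Y * U') (W := U'ᴴ * W) (A := Aᴴ) (B := C) (τ := ∑ i, d i ^ q)
    (by positivity) ((div_lt_one hq0).2 hq) hc hc1 (fun x => hdq _)
    (fun x => Real.rpow_nonneg (hs _ _) _)
    (fun x => (Finset.single_le_sum (f := fun j => s x.1 j ^ q)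
      (fun j _ => Real.rpow_nonneg (hs _ _) _) (Finset.mem_univ x.2.2)).trans (hs1 x.1))
    (l2_opNorm_unitary_le (mul_mem hY hU'))
    (l2_opNorm_unitary_le (mul_mem (Unitary.star_mem hU') hW))
    (by rw [l2_opNorm_conjTranspose]; exact l2_opNorm_stack_kronecker_le hPP hr0 hr1 hFs)
    (l2_opNorm_stack_kronecker_le hPP hr0 hr1 hV)
    (by
      have := sum_weighted_stack_kronecker_le hPP hr1 hFs (b := fun k j => s k j ^ q) hs1
        (fun i => (hdq i).le)
      simpa [A] using this)
    (sum_weighted_stack_kronecker_le hPP hr1 hV (b := fun k j => s k j ^ q) hs1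
        (fun i => (hdq i).le))
  have e1 : ∀ i, (d i ^ q) ^ (1 / q / 2) = √(d i) := fun i => by
    rw [← Real.rpow_mul (hd0 i).le, Real.sqrt_eq_rpow]
    congr 1; field_simp
  have e2 : ∀ x, (β x ^ q) ^ (1 / q) = β x := fun x => by
    rw [← Real.rpow_mul (hs _ _), mul_one_div_cancel hq0.ne', Real.rpow_one]
  simp only [e1, e2] at hinterp
  rw [hfact]
  refine le_trans (le_of_eq ?_) hinterp
  congr 3
  simp only [Matrix.mul_assoc, Δ']

/-- A sum `∑ R k ⊗ B k` with `R k` positive semidefinite has at most the Schatten norm of the matrix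
in which each `B k` is replaced by (a bound for) its norm. -/
theorem schattenNorm_sum_kronecker_le {q : ℝ} (hq : 1 < q) {R : κ → Matrix n n ℂ}
    (hR : ∀ k, (R k).PosSemidef) {B : κ → Matrix m m ℂ} {b : κ → ℝ}
    (hB : ∀ k, schattenNorm q (B k) ≤ b k) :
    schattenNorm q (∑ k, R k ⊗ₖ B k) ≤ schattenNorm q (∑ k, (b k : ℂ) • R k) := by
  have hq0 : 0 < q := by linarith
  have hb : ∀ k, 0 ≤ b k := fun k => (schattenNorm_nonneg _ _).trans (hB k)
  have hR' : ∀ k, ((b k : ℂ) • R k).PosSemidef := fun k =>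
    (hR k).smul (by exact_mod_cast hb k)
  have hB' : ∀ k, schattenNorm q ((((b k)⁻¹ : ℝ) : ℂ) • B k) ≤ 1 := by
    intro k
    rw [schattenNorm_smul hq0 (inv_nonneg.2 (hb k))]
    rcases (hb k).eq_or_lt with h | h
    · simp [← h]
    · rw [inv_mul_le_iff₀ h, mul_one]; exact hB k
  have hprod : ∀ k, R k ⊗ₖ B k = ((b k : ℂ) • R k) ⊗ₖ ((((b k)⁻¹ : ℝ) : ℂ) • B k) := by
    intro k
    rcases (hb k).eq_or_lt with h | h
    · have : B k = 0 := eq_zero_of_schattenNorm_eq_zero hq0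
        (le_antisymm ((hB k).trans h.ge) (schattenNorm_nonneg _ _))
      simp [this]
    · rw [smul_kronecker, kronecker_smul, smul_smul]
      have : (b k : ℂ) ≠ 0 := by exact_mod_cast h.ne'
      simp [this]
  have hT : (∑ k, (b k : ℂ) • R k).PosSemidef := posSemidef_sum _ fun k _ => hR' k
  set U : Matrix n n ℂ := hT.isHermitian.eigenvectorUnitary.1
  have hU : U ∈ unitaryGroup n ℂ := hT.isHermitian.eigenvectorUnitary.2
  set t := hT.isHermitian.eigenvalues
  have ht : ∀ i, 0 ≤ t i := hT.eigenvalues_nonneg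
  have hspec : ∑ k, (b k : ℂ) • R k = U * diagonal (fun i => (t i : ℂ)) * Uᴴ := by
    have := hT.isHermitian.spectral_theorem
    rw [Unitary.conjStarAlgAut_apply] at this
    exact this
  have hnorm : schattenNorm q (∑ k, (b k : ℂ) • R k) = (∑ i, t i ^ q) ^ (1 / q) := by
    rw [hspec, ← star_eq_conjTranspose,
      schattenNorm_svd q hU ht (Unitary.star_mem hU)]
  rw [hnorm]
  simp only [hprod]
  -- `∑ b k • R k` need not be invertible: its eigenvalues are increased by `ε`
  have hε : ∀ ε : ℝ, 0 < ε → schattenNorm q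
      (∑ k, ((b k : ℂ) • R k) ⊗ₖ ((((b k)⁻¹ : ℝ) : ℂ) • B k))
      ≤ (∑ i, (t i + ε) ^ q) ^ (1 / q) := fun ε hε =>
    schattenNorm_sum_kronecker_le_of_lt hq hR' hB' hU ht hspec fun i => by linarith
  have hcont : Continuous fun ε : ℝ => (∑ i, (t i + ε) ^ q) ^ (1 / q) := by
    refine Continuous.rpow_const (continuous_finsetSum _ fun i _ => ?_)
      fun _ => Or.inr (by positivity)
    exact (continuous_const.add continuous_id).rpow_const fun _ => Or.inr hq0.le
  have hlim := (hcont.tendsto 0).mono_left (nhdsWithin_le_nhds (s := Set.Ioi 0))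
  simp only [add_zero] at hlim
  exact ge_of_tendsto hlim (Filter.eventually_of_mem self_mem_nhdsWithin hε)

end Key

/-! ### Duality, Kronecker products and operator norms -/

section SchattenMore

variable {n m : Type*} [Fintype n] [DecidableEq n] [Fintype m] [DecidableEq m]

theorem schattenNorm_unitary_mul_mul (p : ℝ) {U V : Matrix n n ℂ} (hU : U ∈ unitaryGroup n ℂ)
    (hV : V ∈ unitaryGroup n ℂ) (A : Matrix n n ℂ) :
    schattenNorm p (U * A * V) = schattenNorm p A := by
  obtain ⟨F, hF, G, hG, s, hs, rfl⟩ := exists_svd A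
  have : U * (F * diagonal (fun i => (s i : ℂ)) * G) * V
      = (U * F) * diagonal (fun i => (s i : ℂ)) * (G * V) := by simp only [Matrix.mul_assoc]
  rw [this, schattenNorm_svd p (mul_mem hU hF) hs (mul_mem hG hV), schattenNorm_svd p hF hs hG]

theorem schattenNorm_diagonal (p : ℝ) (c : n → ℂ) :
    schattenNorm p (diagonal c) = (∑ i, ‖c i‖ ^ p) ^ (1 / p) := by
  let u : n → ℂ := fun i => if c i = 0 then 1 else c i / ‖c i‖
  have hu : diagonal u ∈ unitaryGroup n ℂ := by
    rw [mem_unitaryGroup_iff, star_eq_conjTranspose, diagonal_conjTranspose, diagonal_mul_diagonal,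
      ← diagonal_one]
    congr 1; ext i
    by_cases h : c i = 0
    · simp [u, h]
    · have h' : (‖c i‖ : ℂ) ≠ 0 := by exact_mod_cast norm_ne_zero_iff.2 h
      simp only [u, h, if_false, Pi.star_apply, ← starRingEnd_apply, map_div₀, Complex.conj_ofReal]
      rw [div_mul_div_comm, Complex.mul_conj, Complex.normSq_eq_norm_sq]
      push_cast
      field_simp
  have hc : diagonal c = diagonal u * diagonal (fun i => ((‖c i‖ : ℝ) : ℂ)) * 1 := by
    rw [Matrix.mul_one, diagonal_mul_diagonal]
    congr 1; ext i
    by_cases h : c i = 0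
    · simp [u, h]
    · have h' : (‖c i‖ : ℂ) ≠ 0 := by exact_mod_cast norm_ne_zero_iff.2 h
      simp only [u, h, if_false]
      field_simp
  rw [hc, schattenNorm_svd p hu (fun i => norm_nonneg _) (one_mem _)]

theorem schattenNorm_kronecker (p : ℝ) (A : Matrix n n ℂ) (B : Matrix m m ℂ) :
    schattenNorm p (A ⊗ₖ B) = schattenNorm p A * schattenNorm p B := by
  obtain ⟨U, hU, V, hV, s, hs, rfl⟩ := exists_svd A
  obtain ⟨F, hF, G, hG, t, ht, rfl⟩ := exists_svd B
  have h : (U * diagonal (fun i => (s i : ℂ)) * V) ⊗ₖ (F * diagonal (fun i => (t i : ℂ)) * G)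
      = (U ⊗ₖ F) * diagonal (fun x : n × m => ((s x.1 * t x.2 : ℝ) : ℂ)) * (V ⊗ₖ G) := by
    rw [mul_kronecker_mul, mul_kronecker_mul, diagonal_kronecker_diagonal]
    simp
  rw [h, schattenNorm_svd p (kronecker_mem_unitaryGroup hU hF)
    (fun x => mul_nonneg (hs _) (ht _)) (kronecker_mem_unitaryGroup hV hG),
    schattenNorm_svd p hU hs hV, schattenNorm_svd p hF ht hG,
    ← Real.mul_rpow (Finset.sum_nonneg fun i _ => Real.rpow_nonneg (hs i) _)
      (Finset.sum_nonneg fun i _ => Real.rpow_nonneg (ht i) _), Finset.sum_mul_sum,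
    Fintype.sum_prod_type]
  simp only [Real.mul_rpow (hs _) (ht _)]

theorem schattenNorm_two_sq (A : Matrix n n ℂ) :
    schattenNorm 2 A ^ 2 = ∑ i, ∑ j, ‖A i j‖ ^ 2 := by
  have h : (CFC.abs A ^ (2 : ℝ) : Matrix n n ℂ) = Aᴴ * A := by
    rw [← star_eq_conjTranspose, ← CFC.abs_mul_abs A, ← pow_two]
    exact CFC.rpow_natCast (CFC.abs A) 2 (CFC.abs_nonneg A)
  have htr : ((Aᴴ * A).trace).re = ∑ i, ∑ j, ‖A i j‖ ^ 2 := by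
    rw [Finset.sum_comm]
    simp only [trace, diag_apply, mul_apply, conjTranspose_apply, ← starRingEnd_apply, mul_comm,
      Complex.mul_conj, Complex.normSq_eq_norm_sq]
    norm_cast
  rw [schattenNorm, h, htr, ← Real.sqrt_eq_rpow, Real.sq_sqrt (by positivity)]

theorem schattenNorm_two (A : Matrix n n ℂ) :
    schattenNorm 2 A = √(∑ i, ∑ j, ‖A i j‖ ^ 2) := by
  rw [← schattenNorm_two_sq, Real.sqrt_sq (schattenNorm_nonneg _ _)]

open scoped Matrix.Norms.Frobenius in
theorem schattenNorm_two_eq_norm (A : Matrix n n ℂ) : schattenNorm 2 A = ‖A‖ := by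
  rw [schattenNorm_two, frobenius_norm_def, Real.sqrt_eq_rpow]
  norm_cast

open scoped Matrix.Norms.Frobenius in
theorem schattenNorm_two_sum_smul_le {ι : Type*} (t : Finset ι) (c : ι → ℂ)
    (M : ι → Matrix n n ℂ) :
    schattenNorm 2 (∑ i ∈ t, c i • M i) ≤ ∑ i ∈ t, ‖c i‖ * schattenNorm 2 (M i) := by
  simp only [schattenNorm_two_eq_norm, ← norm_smul]
  exact norm_sum_le _ _

/-- Hölder's inequality for Schatten norms. The squared moduli of the entries of a unitary matrix
form a doubly stochastic matrix, which reduces it to Hölder's inequality for weighted sums. -/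
theorem norm_trace_mul_le {p q : ℝ} (hpq : p.HolderConjugate q) (A C : Matrix n n ℂ) :
    ‖(A * C).trace‖ ≤ schattenNorm p A * schattenNorm q C := by
  obtain ⟨U, hU, V, hV, s, hs, rfl⟩ := exists_svd A
  obtain ⟨F, hF, G, hG, t, ht, rfl⟩ := exists_svd C
  rw [schattenNorm_svd p hU hs hV, schattenNorm_svd q hF ht hG]
  have hK : V * F ∈ unitaryGroup n ℂ := mul_mem hV hF
  have hL : (G * U)ᴴ ∈ unitaryGroup n ℂ := Unitary.star_mem (mul_mem hG hU)
  set K := V * F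
  have htr : (U * diagonal (fun i => (s i : ℂ)) * V * (F * diagonal (fun i => (t i : ℂ)) * G)).trace
      = ∑ i, ∑ j, (s i : ℂ) * (t j : ℂ) * (K i j * (G * U) j i) := by
    have h1 : U * diagonal (fun i => (s i : ℂ)) * V * (F * diagonal (fun i => (t i : ℂ)) * G)
        = U * (diagonal (fun i => (s i : ℂ)) * (K * (diagonal (fun i => (t i : ℂ)) * G))) := by
      simp only [K, Matrix.mul_assoc]
    have h2 : diagonal (fun i => (s i : ℂ)) * (K * (diagonal (fun i => (t i : ℂ)) * G)) * U
        = diagonal (fun i => (s i : ℂ)) * (K * (diagonal (fun i => (t i : ℂ)) * (G * U))) := by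
      simp only [Matrix.mul_assoc]
    rw [h1, trace_mul_comm, h2]
    simp only [trace, diag_apply, diagonal_mul]
    refine Finset.sum_congr rfl fun i _ => ?_
    rw [mul_apply, Finset.mul_sum]
    refine Finset.sum_congr rfl fun j _ => ?_
    rw [diagonal_mul]; ring
  have hrow : ∀ W ∈ unitaryGroup n ℂ, ∀ i, ∑ j, ‖W i j‖ ^ 2 = 1 := by
    intro W hW i
    have := congrFun (congrFun (mem_unitaryGroup_iff.1 hW) i) i
    rw [star_eq_conjTranspose, mul_apply, one_apply_eq] at this
    simp only [conjTranspose_apply, ← starRingEnd_apply, Complex.mul_conj,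
      Complex.normSq_eq_norm_sq] at this
    exact_mod_cast this
  have hcol : ∀ W ∈ unitaryGroup n ℂ, ∀ j, ∑ i, ‖W i j‖ ^ 2 = 1 := by
    intro W hW j
    have := hrow Wᴴ (Unitary.star_mem hW) j
    simpa using this
  have hp0 := hpq.pos
  have hq0 := hpq.symm.pos
  -- weighted Hölder inequality with the doubly stochastic weights `‖W i j‖ ^ 2`
  have hholder : ∀ W ∈ unitaryGroup n ℂ, ∑ i, ∑ j, s i * t j * ‖W i j‖ ^ 2
      ≤ (∑ i, s i ^ p) ^ (1 / p) * (∑ j, t j ^ q) ^ (1 / q) := by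
    intro W hW
    have hw : ∀ x : n × n, 0 ≤ ‖W x.1 x.2‖ ^ 2 := fun x => by positivity
    have := Real.inner_le_Lp_mul_Lq_of_nonneg (Finset.univ : Finset (n × n)) hpq
      (f := fun x => s x.1 * (‖W x.1 x.2‖ ^ 2) ^ (1 / p))
      (g := fun x => t x.2 * (‖W x.1 x.2‖ ^ 2) ^ (1 / q))
      (fun x _ => mul_nonneg (hs _) (Real.rpow_nonneg (hw x) _))
      (fun x _ => mul_nonneg (ht _) (Real.rpow_nonneg (hw x) _))
    have e0 : ∀ x : n × n, s x.1 * (‖W x.1 x.2‖ ^ 2) ^ (1 / p) *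
        (t x.2 * (‖W x.1 x.2‖ ^ 2) ^ (1 / q)) = s x.1 * t x.2 * ‖W x.1 x.2‖ ^ 2 := by
      intro x
      have h1 : 1 / p + 1 / q = 1 := by simpa using hpq.inv_add_inv_eq_one
      have h2 : (‖W x.1 x.2‖ ^ 2) ^ (1 / p) * (‖W x.1 x.2‖ ^ 2) ^ (1 / q) = ‖W x.1 x.2‖ ^ 2 := by
        rw [← Real.rpow_add' (hw x) (by rw [h1]; exact one_ne_zero), h1, Real.rpow_one]
      calc _ = s x.1 * t x.2 *
            ((‖W x.1 x.2‖ ^ 2) ^ (1 / p) * (‖W x.1 x.2‖ ^ 2) ^ (1 / q)) := by ring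
        _ = _ := by rw [h2]
    have e1 : ∀ x : n × n, (s x.1 * (‖W x.1 x.2‖ ^ 2) ^ (1 / p)) ^ p
        = s x.1 ^ p * ‖W x.1 x.2‖ ^ 2 := by
      intro x
      rw [Real.mul_rpow (hs _) (Real.rpow_nonneg (hw x) _), ← Real.rpow_mul (hw x),
        one_div_mul_cancel hp0.ne', Real.rpow_one]
    have e2 : ∀ x : n × n, (t x.2 * (‖W x.1 x.2‖ ^ 2) ^ (1 / q)) ^ q
        = t x.2 ^ q * ‖W x.1 x.2‖ ^ 2 := by
      intro x
      rw [Real.mul_rpow (ht _) (Real.rpow_nonneg (hw x) _), ← Real.rpow_mul (hw x),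
        one_div_mul_cancel hq0.ne', Real.rpow_one]
    simp only [e0, e1, e2, Fintype.sum_prod_type] at this
    have e3 : ∑ i, ∑ j, s i ^ p * ‖W i j‖ ^ 2 = ∑ i, s i ^ p := by
      simp only [← Finset.mul_sum, hrow W hW, mul_one]
    have e4 : ∑ i, ∑ j, t j ^ q * ‖W i j‖ ^ 2 = ∑ j, t j ^ q := by
      rw [Finset.sum_comm]
      simp only [← Finset.mul_sum, hcol W hW, mul_one]
    rwa [e3, e4] at this
  have h1 := hholder K hK
  have h2 := hholder _ hL
  rw [htr]
  calc ‖∑ i, ∑ j, (s i : ℂ) * (t j : ℂ) * (K i j * (G * U) j i)‖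
      ≤ ∑ i, ∑ j, (s i * t j * ‖K i j‖ ^ 2 + s i * t j * ‖(G * U)ᴴ i j‖ ^ 2) / 2 := by
        refine (norm_sum_le _ _).trans (Finset.sum_le_sum fun i _ =>
          (norm_sum_le _ _).trans (Finset.sum_le_sum fun j _ => ?_))
        rw [norm_mul, norm_mul, norm_mul, Complex.norm_real, Complex.norm_real,
          Real.norm_of_nonneg (hs i), Real.norm_of_nonneg (ht j), conjTranspose_apply, norm_star]
        nlinarith [mul_nonneg (mul_nonneg (hs i) (ht j)) (sq_nonneg (‖K i j‖ - ‖(G * U) j i‖))]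
    _ ≤ _ := by
        simp only [← Finset.sum_div, Finset.sum_add_distrib]
        linarith

/-- The converse of Hölder's inequality: the Schatten `q`-norm is dual to the Schatten `p`-norm. -/
theorem schattenNorm_le_of_forall_trace_mul {p q x : ℝ} (hpq : p.HolderConjugate q)
    {G : Matrix n n ℂ} (h : ∀ C : Matrix n n ℂ, schattenNorm q C ≤ 1 → ‖(G * C).trace‖ ≤ x) :
    schattenNorm p G ≤ x := by
  refine schattenNorm_le_of_norm_trace_le hpq.lt fun Y hY W hW c hc hc1 => ?_
  have e : 1 - 1 / p = 1 / q := by simpa using hpq.one_sub_inv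
  have hq0 := hpq.symm.pos
  have h1 := h (W * diagonal (fun i => ((c i ^ (1 - 1 / p) : ℝ) : ℂ)) * Y) (by
    rw [schattenNorm_svd q hW (fun i => Real.rpow_nonneg (hc i) _) hY, e]
    refine Real.rpow_le_one (Finset.sum_nonneg fun i _ =>
      Real.rpow_nonneg (Real.rpow_nonneg (hc i) _) _) ?_ (by positivity)
    simpa only [← Real.rpow_mul (hc _), one_div_mul_cancel hq0.ne', Real.rpow_one] using hc1)
  refine le_trans (le_of_eq ?_) h1
  rw [show G * (W * diagonal (fun i => ((c i ^ (1 - 1 / p) : ℝ) : ℂ)) * Y)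
    = (G * W) * diagonal (fun i => ((c i ^ (1 - 1 / p) : ℝ) : ℂ)) * Y by
      simp only [Matrix.mul_assoc], trace_mul_cycle, trace_mul_comm]
  simp only [Matrix.mul_assoc]

theorem schattenNorm_le_schattenNorm_one {p : ℝ} (hp : 1 ≤ p) (A : Matrix n n ℂ) :
    schattenNorm p A ≤ schattenNorm 1 A := by
  obtain ⟨U, hU, V, hV, s, hs, rfl⟩ := exists_svd A
  rw [schattenNorm_svd p hU hs hV, schattenNorm_svd 1 hU hs hV]
  simp only [Real.rpow_one, one_div_one]
  set S := ∑ i, s i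
  have hS : 0 ≤ S := Finset.sum_nonneg fun i _ => hs i
  have hle : ∀ i, s i ≤ S := fun i =>
    Finset.single_le_sum (fun j _ => hs j) (Finset.mem_univ i)
  have hpow : ∀ x : ℝ, 0 ≤ x → x ^ p = x * x ^ (p - 1) := fun x hx => by
    rw [mul_comm, ← Real.rpow_add_one' hx (by linarith), sub_add_cancel]
  have h : ∑ i, s i ^ p ≤ S ^ p := by
    rw [hpow S hS, Finset.sum_mul]
    refine Finset.sum_le_sum fun i _ => ?_
    rw [hpow _ (hs i)]
    exact mul_le_mul_of_nonneg_left (Real.rpow_le_rpow (hs i) (hle i) (by linarith)) (hs i)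
  calc _ ≤ (S ^ p) ^ (1 / p) := by
        refine Real.rpow_le_rpow (Finset.sum_nonneg fun i _ => Real.rpow_nonneg (hs i) _) h
          (by positivity)
    _ = S := by rw [← Real.rpow_mul hS, mul_one_div_cancel (by linarith), Real.rpow_one]

/-- The dimension is increased by one so that the constant tends to `1` as `p` tends to `1` in
dimension `0` too. -/
theorem schattenNorm_one_le {p : ℝ} (hp : 1 < p) (A : Matrix n n ℂ) :
    schattenNorm 1 A ≤ (Fintype.card n + 1 : ℝ) ^ (1 - 1 / p) * schattenNorm p A := by
  obtain ⟨U, hU, V, hV, s, hs, rfl⟩ := exists_svd A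
  rw [schattenNorm_svd p hU hs hV, schattenNorm_svd 1 hU hs hV]
  simp only [Real.rpow_one, one_div_one]
  have hpq := Real.HolderConjugate.conjExponent hp
  have := Real.inner_le_Lp_mul_Lq_of_nonneg Finset.univ hpq (f := s) (g := fun _ => 1)
    (fun i _ => hs i) (fun i _ => zero_le_one)
  simp only [mul_one, Real.one_rpow, Finset.sum_const, Finset.card_univ, nsmul_eq_mul] at this
  have e : 1 - 1 / p = 1 / p.conjExponent := by simpa using hpq.one_sub_inv
  rw [e, mul_comm]
  refine this.trans ?_
  have := hpq.symm.pos
  gcongr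
  · exact Real.rpow_nonneg (Finset.sum_nonneg fun i _ => Real.rpow_nonneg (hs i) _) _
  · linarith

end SchattenMore

section NormPQ

variable {m n m' n' : Type*} [Fintype m] [DecidableEq m] [Fintype n] [DecidableEq n]
  [Fintype m'] [DecidableEq m'] [Fintype n'] [DecidableEq n']

theorem normPQ_le_ofReal {p q x : ℝ} (hx : 0 ≤ x) {L : Matrix m m ℂ →ₗ[ℂ] Matrix n n ℂ}
    (h : ∀ A, schattenNorm q (L A) ≤ x * schattenNorm p A) : normPQ p q L ≤ ENNReal.ofReal x :=
  iSup_le fun A => ENNReal.ofReal_le_ofReal (div_le_of_le_mul₀ (schattenNorm_nonneg _ _) hx (h A))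

theorem schattenNorm_apply_le {p q : ℝ} (hp : 0 < p) (hq : 0 < q)
    {L : Matrix m m ℂ →ₗ[ℂ] Matrix n n ℂ} (hL : normPQ p q L ≠ ⊤) (A : Matrix m m ℂ) :
    schattenNorm q (L A) ≤ (normPQ p q L).toReal * schattenNorm p A := by
  rcases (schattenNorm_nonneg p A).eq_or_lt with h | h
  · rw [eq_zero_of_schattenNorm_eq_zero hp h.symm, map_zero, schattenNorm_zero hq,
      schattenNorm_zero hp, mul_zero]
  · rw [← div_le_iff₀ h]
    exact (ENNReal.ofReal_le_iff_le_toReal hL).1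
      (le_iSup (fun A => ENNReal.ofReal (schattenNorm q (L A) / schattenNorm p A)) A)

theorem eq_zero_of_normPQ_eq_zero {p q : ℝ} (hp : 0 < p) (hq : 0 < q)
    {L : Matrix m m ℂ →ₗ[ℂ] Matrix n n ℂ} (hL : normPQ p q L = 0) : L = 0 := by
  ext1 A
  refine eq_zero_of_schattenNorm_eq_zero hq (le_antisymm ?_ (schattenNorm_nonneg _ _))
  have hL' : normPQ p q L ≠ ⊤ := by simp [hL]
  simpa [hL] using schattenNorm_apply_le hp hq hL' A

theorem normPQ_zero {p q : ℝ} (hq : 0 < q) :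
    normPQ p q (0 : Matrix m m ℂ →ₗ[ℂ] Matrix n n ℂ) = 0 := by
  simp [normPQ, schattenNorm_zero hq]

theorem tensorMap_zero_left (K : Matrix n n ℂ →ₗ[ℂ] Matrix n' n' ℂ) :
    tensorMap (0 : Matrix m m ℂ →ₗ[ℂ] Matrix m' m' ℂ) K = 0 := by
  simp [tensorMap]

theorem tensorMap_zero_right (L : Matrix m m ℂ →ₗ[ℂ] Matrix m' m' ℂ) :
    tensorMap L (0 : Matrix n n ℂ →ₗ[ℂ] Matrix n' n' ℂ) = 0 := by
  simp [tensorMap]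

/-- Submultiplicativity of `normPQ` reduces to bounds with real constants. Infinite norms need no
separate proof of finiteness: they only matter next to a factor `0`, and then one map vanishes. -/
theorem normPQ_tensorMap_le {p q : ℝ} (hp : 0 < p) (hq : 0 < q)
    {L : Matrix m m ℂ →ₗ[ℂ] Matrix m' m' ℂ} {K : Matrix n n ℂ →ₗ[ℂ] Matrix n' n' ℂ}
    (h : ∀ x y : ℝ, 0 ≤ x → 0 ≤ y → (∀ A, schattenNorm q (L A) ≤ x * schattenNorm p A) →
      (∀ B, schattenNorm q (K B) ≤ y * schattenNorm p B) →
      ∀ M, schattenNorm q (tensorMap L K M) ≤ x * y * schattenNorm p M) :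
    normPQ p q (tensorMap L K) ≤ normPQ p q L * normPQ p q K := by
  by_cases hL0 : normPQ p q L = 0
  · rw [eq_zero_of_normPQ_eq_zero hp hq hL0, tensorMap_zero_left, normPQ_zero hq]; exact zero_le
  by_cases hK0 : normPQ p q K = 0
  · rw [eq_zero_of_normPQ_eq_zero hp hq hK0, tensorMap_zero_right, normPQ_zero hq]; exact zero_le
  by_cases hL : normPQ p q L = ⊤
  · rw [hL, ENNReal.top_mul hK0]; exact le_top
  by_cases hK : normPQ p q K = ⊤
  · rw [hK, ENNReal.mul_top hL0]; exact le_top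
  rw [← ENNReal.ofReal_toReal hL, ← ENNReal.ofReal_toReal hK,
    ← ENNReal.ofReal_mul ENNReal.toReal_nonneg]
  exact normPQ_le_ofReal (by positivity) (h _ _ ENNReal.toReal_nonneg ENNReal.toReal_nonneg
    (schattenNorm_apply_le hp hq hL) (schattenNorm_apply_le hp hq hK))

theorem mul_normPQ_le_normPQ_tensorMap (p q : ℝ)
    (L : Matrix m m ℂ →ₗ[ℂ] Matrix m' m' ℂ) (K : Matrix n n ℂ →ₗ[ℂ] Matrix n' n' ℂ) :
    normPQ p q L * normPQ p q K ≤ normPQ p q (tensorMap L K) := by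
  simp only [normPQ, ENNReal.iSup_mul, ENNReal.mul_iSup]
  refine iSup_le fun B => iSup_le fun A => ?_
  refine le_iSup_of_le (A ⊗ₖ B) (le_of_eq ?_)
  rw [← ENNReal.ofReal_mul (div_nonneg (schattenNorm_nonneg _ _) (schattenNorm_nonneg _ _))]
  congr 1
  have : tensorMap L K (A ⊗ₖ B) = L A ⊗ₖ K B := tensorMap_kronecker L K A B
  rw [this, schattenNorm_kronecker, schattenNorm_kronecker, div_mul_div_comm]

/-- `L` and `L'` are transposes of each other for the bilinear trace pairing `Tr (A B)`. -/
def IsTracePair (L : Matrix m m ℂ →ₗ[ℂ] Matrix n n ℂ) (L' : Matrix n n ℂ →ₗ[ℂ] Matrix m m ℂ) :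
    Prop :=
  ∀ A B, (L A * B).trace = (A * L' B).trace

omit [DecidableEq m] [DecidableEq n] in
theorem IsTracePair.symm {L : Matrix m m ℂ →ₗ[ℂ] Matrix n n ℂ}
    {L' : Matrix n n ℂ →ₗ[ℂ] Matrix m m ℂ} (h : IsTracePair L L') : IsTracePair L' L :=
  fun A B => by rw [trace_mul_comm, ← h, trace_mul_comm]

theorem exists_isTracePair (L : Matrix m m ℂ →ₗ[ℂ] Matrix n n ℂ) : ∃ L', IsTracePair L L' := by
  refine ⟨{ toFun := fun B => of fun j i => (L (single i j 1) * B).trace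
            map_add' := fun A B => by ext; simp [mul_add]
            map_smul' := fun c A => by ext; simp }, fun A B => ?_⟩
  conv_lhs => rw [matrix_eq_sum_single A]
  have : ∀ i j, single i j (A i j) = A i j • single i j (1 : ℂ) := fun i j => by simp
  simp only [this, map_sum, map_smul, Matrix.sum_mul, trace_sum, smul_mul_assoc, trace_smul]
  simp [trace, mul_apply]

/-- Every matrix on a product index set is a sum of Kronecker products. -/
theorem kronecker_induction {motive : Matrix (m × n) (m × n) ℂ → Prop}
    (zero : motive 0) (kronecker : ∀ A B, motive (A ⊗ₖ B))
    (add : ∀ M N, motive M → motive N → motive (M + N)) (M : Matrix (m × n) (m × n) ℂ) :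
    motive M := by
  obtain ⟨t, rfl⟩ := (kroneckerLinearEquiv m m n n ℂ).surjective M
  induction t with
  | zero => simpa using zero
  | tmul A B => simpa using kronecker A B
  | add x y hx hy => simpa using add _ _ hx hy

theorem IsTracePair.tensorMap {L : Matrix m m ℂ →ₗ[ℂ] Matrix m' m' ℂ}
    {L' : Matrix m' m' ℂ →ₗ[ℂ] Matrix m m ℂ} {K : Matrix n n ℂ →ₗ[ℂ] Matrix n' n' ℂ}
    {K' : Matrix n' n' ℂ →ₗ[ℂ] Matrix n n ℂ} (hL : IsTracePair L L') (hK : IsTracePair K K') :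
    IsTracePair (tensorMap L K) (tensorMap L' K') := by
  intro M N
  induction M using kronecker_induction with
  | zero => simp
  | add M M' h h' => simp [add_mul, h, h']
  | kronecker A B =>
    induction N using kronecker_induction with
    | zero => simp
    | add N N' h h' => simp [mul_add, h, h']
    | kronecker C D =>
      have h1 : MatrixMaps.tensorMap L K (A ⊗ₖ B) = L A ⊗ₖ K B := tensorMap_kronecker L K A B
      have h2 : MatrixMaps.tensorMap L' K' (C ⊗ₖ D) = L' C ⊗ₖ K' D := tensorMap_kronecker L' K' C D
      rw [h1, h2, ← mul_kronecker_mul, ← mul_kronecker_mul, trace_kronecker, trace_kronecker,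
        hL, hK]

theorem IsTracePair.normPQ_le {p q r s : ℝ} (hpq : p.HolderConjugate q) (hrs : r.HolderConjugate s)
    {L : Matrix m m ℂ →ₗ[ℂ] Matrix n n ℂ} {L' : Matrix n n ℂ →ₗ[ℂ] Matrix m m ℂ}
    (h : IsTracePair L L') : normPQ p r L ≤ normPQ s q L' := by
  by_cases hL : normPQ s q L' = ⊤
  · rw [hL]; exact le_top
  rw [← ENNReal.ofReal_toReal hL]
  refine normPQ_le_ofReal ENNReal.toReal_nonneg fun A => ?_
  refine schattenNorm_le_of_forall_trace_mul hrs fun C hC => ?_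
  rw [h]
  have h1 := schattenNorm_apply_le hrs.symm.pos hpq.symm.pos hL C
  calc _ ≤ schattenNorm p A * schattenNorm q (L' C) := norm_trace_mul_le hpq _ _
    _ ≤ schattenNorm p A * ((normPQ s q L').toReal * schattenNorm s C) := by
        gcongr; exact schattenNorm_nonneg _ _
    _ ≤ schattenNorm p A * ((normPQ s q L').toReal * 1) := by
        gcongr; exact schattenNorm_nonneg _ _
    _ = _ := by ring

theorem normPQ_one_le {p q : ℝ} (hp : 1 ≤ p) (hq : 0 < q) (L : Matrix m m ℂ →ₗ[ℂ] Matrix n n ℂ) :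
    normPQ 1 q L ≤ normPQ p q L := by
  by_cases hL : normPQ p q L = ⊤
  · rw [hL]; exact le_top
  rw [← ENNReal.ofReal_toReal hL]
  refine normPQ_le_ofReal ENNReal.toReal_nonneg fun A => ?_
  exact (schattenNorm_apply_le (by linarith) hq hL A).trans
    (mul_le_mul_of_nonneg_left (schattenNorm_le_schattenNorm_one hp A) ENNReal.toReal_nonneg)

theorem normPQ_le_mul_normPQ_one {p q : ℝ} (hp : 1 < p) (hq : 0 < q)
    (L : Matrix m m ℂ →ₗ[ℂ] Matrix n n ℂ) :
    normPQ p q L ≤ ENNReal.ofReal ((Fintype.card m + 1 : ℝ) ^ (1 - 1 / p)) * normPQ 1 q L := by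
  have hc : 0 < (Fintype.card m + 1 : ℝ) ^ (1 - 1 / p) := by positivity
  by_cases hL : normPQ 1 q L = ⊤
  · rw [hL, ENNReal.mul_top (ENNReal.ofReal_pos.2 hc).ne']; exact le_top
  rw [← ENNReal.ofReal_toReal hL, ← ENNReal.ofReal_mul hc.le]
  refine normPQ_le_ofReal (by positivity) fun A => ?_
  calc _ ≤ (normPQ 1 q L).toReal * schattenNorm 1 A := schattenNorm_apply_le one_pos hq hL A
    _ ≤ (normPQ 1 q L).toReal * ((Fintype.card m + 1 : ℝ) ^ (1 - 1 / p) * schattenNorm p A) := by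
        gcongr; exact schattenNorm_one_le hp A
    _ = _ := by ring

/-- Submultiplicativity for exponents `p > 1` passes to `p = 1`, by continuity of `p ↦ ‖L‖_{p→q}`
at `1`. -/
theorem normPQ_one_tensorMap_le {q p₀ : ℝ} (hp₀ : 1 < p₀) (hq : 0 < q)
    {L : Matrix m m ℂ →ₗ[ℂ] Matrix m' m' ℂ} {K : Matrix n n ℂ →ₗ[ℂ] Matrix n' n' ℂ}
    (h : ∀ p, 1 < p → p < p₀ → normPQ p q (tensorMap L K) ≤ normPQ p q L * normPQ p q K) :
    normPQ 1 q (tensorMap L K) ≤ normPQ 1 q L * normPQ 1 q K := by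
  set c : ℝ := (Fintype.card m + 1) * (Fintype.card n + 1)
  have hc : 0 < c := by positivity
  have hle : ∀ p, 1 < p → p < p₀ → normPQ 1 q (tensorMap L K)
      ≤ ENNReal.ofReal (c ^ (1 - 1 / p)) * (normPQ 1 q L * normPQ 1 q K) := by
    intro p hp hp'
    refine ((normPQ_one_le hp.le hq _).trans (h p hp hp')).trans ?_
    refine (mul_le_mul' (normPQ_le_mul_normPQ_one hp hq L)
      (normPQ_le_mul_normPQ_one hp hq K)).trans (le_of_eq ?_)
    rw [mul_mul_mul_comm, ← ENNReal.ofReal_mul (by positivity),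
      ← Real.mul_rpow (by positivity) (by positivity)]
  have hcont : Filter.Tendsto (fun p : ℝ => c ^ (1 - 1 / p)) (nhdsWithin 1 (Set.Ioi 1))
      (nhds (c ^ (1 - 1 / (1 : ℝ)))) := by
    refine Filter.Tendsto.mono_left (ContinuousAt.tendsto ?_) nhdsWithin_le_nhds
    exact continuousAt_const.rpow (continuousAt_const.sub
      (continuousAt_const.div continuousAt_id one_ne_zero)) (Or.inl hc.ne')
  have hlim := ENNReal.Tendsto.mul_const (b := normPQ 1 q L * normPQ 1 q K)
    (ENNReal.tendsto_ofReal hcont) (Or.inl (by simp))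
  simp only [div_one, sub_self, Real.rpow_zero, ENNReal.ofReal_one, one_mul] at hlim
  refine ge_of_tendsto hlim ?_
  filter_upwards [Ioo_mem_nhdsGT hp₀] with p hp using hle p hp.1 hp.2

end NormPQ

/-! ### Entanglement-breaking maps -/

section Slice

variable {d d' N : ℕ} {m n : Type*} [Fintype m] [DecidableEq m] [Fintype n] [DecidableEq n]

/-- The partial trace `Tr₁ ((X ⊗ 1) M)` of a matrix on a product index set, over the first factor.
-/
def slice {l : Type*} [Fintype l] (X : Matrix l l ℂ) (M : Matrix (l × m) (l × m) ℂ) :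
    Matrix m m ℂ :=
  of fun a b => ∑ i, ∑ j, X j i * M (i, a) (j, b)

omit [Fintype m] [DecidableEq m] in
theorem slice_apply (X : Matrix (Fin d) (Fin d) ℂ) (M : Matrix (Fin d × m) (Fin d × m) ℂ)
    (a b : m) : slice X M a b = ((of fun i j => M (i, a) (j, b)) * X).trace := by
  simp only [slice, of_apply, trace, diag_apply, mul_apply, mul_comm]

theorem tensorMap_ebMap (X : Fin N → Matrix (Fin d) (Fin d) ℂ)
    (R : Fin N → Matrix (Fin d') (Fin d') ℂ)
    (Ω : Matrix m m ℂ →ₗ[ℂ] Matrix n n ℂ) (M : Matrix (Fin d × m) (Fin d × m) ℂ) :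
    tensorMap (ebMap X R) Ω M = ∑ k, R k ⊗ₖ Ω (slice (X k) M) := by
  induction M using kronecker_induction with
  | zero =>
    have : ∀ k, slice (X k) (0 : Matrix (Fin d × m) (Fin d × m) ℂ) = 0 := fun k => by
      ext; simp [slice]
    simp [this]
  | add M M' h h' =>
    have : ∀ k, slice (X k) (M + M') = slice (X k) M + slice (X k) M' := fun k => by
      ext; simp [slice, mul_add, Finset.sum_add_distrib]
    simp [this, h, h', kronecker_add, Finset.sum_add_distrib]
  | kronecker A B =>
    have h : ∀ k, slice (X k) (A ⊗ₖ B) = (A * X k).trace • B := fun k => by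
      ext a b
      simp only [slice, of_apply, kroneckerMap_apply, trace, diag_apply, mul_apply,
        Matrix.smul_apply, smul_eq_mul, Finset.sum_mul]
      exact Finset.sum_congr rfl fun i _ => Finset.sum_congr rfl fun j _ => by ring
    have h1 : tensorMap (ebMap X R) Ω (A ⊗ₖ B) = ebMap X R A ⊗ₖ Ω B := tensorMap_kronecker _ _ A B
    rw [h1]
    ext x y
    simp [h, ebMap, Matrix.sum_apply, Finset.sum_mul]
    exact Finset.sum_congr rfl fun i _ => by ring

theorem isTracePair_ebMap (X : Fin N → Matrix (Fin d) (Fin d) ℂ)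
    (R : Fin N → Matrix (Fin d') (Fin d') ℂ) : IsTracePair (ebMap X R) (ebMap R X) := by
  intro A B
  simp only [ebMap, LinearMap.coe_mk, AddHom.coe_mk, Matrix.sum_mul, Matrix.mul_sum, trace_sum,
    smul_mul_assoc, mul_smul_comm, trace_smul, smul_eq_mul]
  exact Finset.sum_congr rfl fun k _ => by rw [trace_mul_comm (R k) B, mul_comm]

theorem schattenNorm_two_sq_eq_sum_blocks {l : Type*} [Fintype l] [DecidableEq l]
    (M : Matrix (l × m) (l × m) ℂ) :
    schattenNorm 2 M ^ 2 = ∑ a, ∑ b, schattenNorm 2 (of fun i j => M (i, a) (j, b)) ^ 2 := by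
  simp only [schattenNorm_two_sq, of_apply, Fintype.sum_prod_type]
  rw [Finset.sum_comm]
  refine Finset.sum_congr rfl fun a _ => ?_
  exact (Finset.sum_congr rfl fun i _ => Finset.sum_comm).trans Finset.sum_comm

end Slice

section Bounds

variable {d d' N : ℕ} {m n : Type*} [Fintype m] [DecidableEq m] [Fintype n] [DecidableEq n]
  {X : Fin N → Matrix (Fin d) (Fin d) ℂ} {R : Fin N → Matrix (Fin d') (Fin d') ℂ}
  {Ω : Matrix m m ℂ →ₗ[ℂ] Matrix n n ℂ} {q x y : ℝ}

/-- The key bound, applied to `B k = Ω (slice (X k) M)`. -/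
theorem schattenNorm_tensorMap_ebMap_le (hq : 1 < q) (hR : ∀ k, (R k).PosSemidef) (hy : 0 ≤ y)
    (hΩ : ∀ B, schattenNorm q (Ω B) ≤ y * schattenNorm 2 B) {M : Matrix (Fin d × m) (Fin d × m) ℂ}
    {b : Fin N → ℝ} (hb : ∀ k, schattenNorm 2 (slice (X k) M) ≤ b k) :
    schattenNorm q (tensorMap (ebMap X R) Ω M)
      ≤ y * schattenNorm q (∑ k, (b k : ℂ) • R k) := by
  rw [tensorMap_ebMap]
  have := schattenNorm_sum_kronecker_le hq hR (B := fun k => Ω (slice (X k) M))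
    (b := fun k => y * b k) fun k => (hΩ _).trans (mul_le_mul_of_nonneg_left (hb k) hy)
  refine this.trans (le_of_eq ?_)
  rw [← schattenNorm_smul (by linarith) hy, Finset.smul_sum]
  simp only [smul_smul, Complex.ofReal_mul]

/-- It suffices to find a matrix `A` on the first factor that majorizes `M`: its norm is at most
that of `M`, and `Tr (A X_k)` is at least the norm of the partial trace of `M` against `X_k`. -/
theorem schattenNorm_tensorMap_ebMap_le_of_majorant (hq : 1 < q) (hR : ∀ k, (R k).PosSemidef)
    (hx : 0 ≤ x) (hy : 0 ≤ y) (hΦ : ∀ A, schattenNorm q (ebMap X R A) ≤ x * schattenNorm 2 A)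
    (hΩ : ∀ B, schattenNorm q (Ω B) ≤ y * schattenNorm 2 B) {M : Matrix (Fin d × m) (Fin d × m) ℂ}
    {A : Matrix (Fin d) (Fin d) ℂ} (hA : schattenNorm 2 A ≤ schattenNorm 2 M)
    {b : Fin N → ℝ} (hAb : ∀ k, (A * X k).trace = b k)
    (hb : ∀ k, schattenNorm 2 (slice (X k) M) ≤ b k) :
    schattenNorm q (tensorMap (ebMap X R) Ω M) ≤ x * y * schattenNorm 2 M := by
  have h := schattenNorm_tensorMap_ebMap_le hq hR hy hΩ hb
  have hsum : ∑ k, (b k : ℂ) • R k = ebMap X R A := by simp [ebMap, hAb]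
  rw [hsum] at h
  calc _ ≤ y * (x * schattenNorm 2 A) := h.trans (mul_le_mul_of_nonneg_left (hΦ A) hy)
    _ ≤ y * (x * schattenNorm 2 M) := by gcongr
    _ = _ := by ring

/-- For entrywise nonnegative `X k`, the majorant of `M` is the matrix of the Hilbert–Schmidt norms
of its blocks. -/
theorem schattenNorm_tensorMap_ebMap_le_of_entries_nonneg (hq : 1 < q)
    (hR : ∀ k, (R k).PosSemidef) (hX : ∀ k i j, 0 ≤ X k i j)
    (hx : 0 ≤ x) (hy : 0 ≤ y) (hΦ : ∀ A, schattenNorm q (ebMap X R A) ≤ x * schattenNorm 2 A)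
    (hΩ : ∀ B, schattenNorm q (Ω B) ≤ y * schattenNorm 2 B)
    (M : Matrix (Fin d × m) (Fin d × m) ℂ) :
    schattenNorm q (tensorMap (ebMap X R) Ω M) ≤ x * y * schattenNorm 2 M := by
  let block : Fin d → Fin d → Matrix m m ℂ := fun i j => of fun a b => M (i, a) (j, b)
  have hre : ∀ k i j, X k i j = ((X k i j).re : ℂ) := fun k i j =>
    Complex.eq_re_of_ofReal_le (r := 0) (by simpa using hX k i j)
  have hre0 : ∀ k i j, 0 ≤ (X k i j).re := fun k i j => (Complex.nonneg_iff.1 (hX k i j)).1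
  refine schattenNorm_tensorMap_ebMap_le_of_majorant hq hR hx hy hΦ hΩ
    (A := of fun i j => (schattenNorm 2 (block i j) : ℂ))
    (b := fun k => ∑ i, ∑ j, (X k j i).re * schattenNorm 2 (block i j)) (le_of_eq ?_) ?_ ?_
  · rw [← sq_eq_sq₀ (schattenNorm_nonneg _ _) (schattenNorm_nonneg _ _), schattenNorm_two_sq,
      schattenNorm_two_sq]
    simp only [of_apply, Complex.norm_real, Real.norm_of_nonneg (schattenNorm_nonneg _ _),
      schattenNorm_two_sq, Fintype.sum_prod_type, block]
    exact Finset.sum_congr rfl fun i _ => Finset.sum_comm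
  · intro k
    simp only [trace, diag_apply, mul_apply, of_apply]
    push_cast
    refine Finset.sum_congr rfl fun i _ => Finset.sum_congr rfl fun j _ => ?_
    rw [← hre, mul_comm]
  · intro k
    have hs : slice (X k) M = ∑ p : Fin d × Fin d, X k p.2 p.1 • block p.1 p.2 := by
      ext a b
      simp [slice, block, Matrix.sum_apply, Fintype.sum_prod_type]
    rw [hs]
    refine (schattenNorm_two_sum_smul_le _ _ _).trans (le_of_eq ?_)
    rw [Fintype.sum_prod_type]
    refine Finset.sum_congr rfl fun i _ => Finset.sum_congr rfl fun j _ => ?_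
    rw [hre, Complex.norm_real, Real.norm_of_nonneg (hre0 _ _ _), Complex.ofReal_re]

theorem trace_mul_conj_single (A U : Matrix (Fin d) (Fin d) ℂ) (k : Fin d) :
    (A * (U * single k k 1 * Uᴴ)).trace = (Uᴴ * A * U) k k := by
  rw [show A * (U * single k k 1 * Uᴴ) = (A * U) * single k k 1 * Uᴴ by
    simp only [Matrix.mul_assoc], trace_mul_comm, ← Matrix.mul_assoc, ← Matrix.mul_assoc,
    trace_mul_comm, trace_single_mul]
  simp

theorem sum_smul_conj_single (U : Matrix (Fin d) (Fin d) ℂ) (c : Fin d → ℂ) :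
    ∑ k, c k • (U * single k k 1 * Uᴴ) = U * diagonal c * Uᴴ := by
  have : diagonal c = ∑ k, c k • single k k (1 : ℂ) := by
    rw [← sum_single_eq_diagonal]; simp
  simp only [this, Matrix.mul_sum, Matrix.sum_mul, mul_smul_comm, smul_mul_assoc]

theorem posSemidef_conj_single (U : Matrix (Fin d) (Fin d) ℂ) (k : Fin d) :
    (U * single k k 1 * Uᴴ).PosSemidef := by
  refine PosSemidef.mul_mul_conjTranspose_same ?_ U
  rw [← diagonal_single]
  exact PosSemidef.diagonal fun i => by
    by_cases h : i = k
    · subst h; simp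
    · simp [h]

theorem schattenNorm_conj_diagonal (q : ℝ) {U : Matrix (Fin d) (Fin d) ℂ}
    (hU : U ∈ unitaryGroup (Fin d) ℂ) (c : Fin d → ℂ) :
    schattenNorm q (U * diagonal c * Uᴴ) = (∑ k, ‖c k‖ ^ q) ^ (1 / q) := by
  rw [← star_eq_conjTranspose, schattenNorm_unitary_mul_mul q hU (Unitary.star_mem hU),
    schattenNorm_diagonal]

/-- When the `X k` are the projections onto an orthonormal basis, the majorant of `M` is diagonal in
that basis. -/
theorem schattenNorm_tensorMap_ebMap_le_of_left_projections (hq : 1 < q)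
    {R : Fin d → Matrix (Fin d') (Fin d') ℂ} (hR : ∀ k, (R k).PosSemidef)
    {U : Matrix (Fin d) (Fin d) ℂ} (hU : U ∈ unitaryGroup (Fin d) ℂ)
    {X : Fin d → Matrix (Fin d) (Fin d) ℂ} (hX : ∀ k, X k = U * single k k 1 * Uᴴ)
    (hx : 0 ≤ x) (hy : 0 ≤ y) (hΦ : ∀ A, schattenNorm q (ebMap X R A) ≤ x * schattenNorm 2 A)
    (hΩ : ∀ B, schattenNorm q (Ω B) ≤ y * schattenNorm 2 B)
    (M : Matrix (Fin d × m) (Fin d × m) ℂ) :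
    schattenNorm q (tensorMap (ebMap X R) Ω M) ≤ x * y * schattenNorm 2 M := by
  let β : Fin d → ℝ := fun k => schattenNorm 2 (slice (X k) M)
  have hUU : Uᴴ * U = 1 := mem_unitaryGroup_iff'.1 hU
  refine schattenNorm_tensorMap_ebMap_le_of_majorant hq hR hx hy hΦ hΩ
    (A := U * diagonal (fun k => (β k : ℂ)) * Uᴴ) (b := β) ?_ ?_ (fun k => le_rfl)
  · refine (pow_le_pow_iff_left₀ (schattenNorm_nonneg _ _) (schattenNorm_nonneg _ _)
      two_ne_zero).1 ?_
    have hdiag : schattenNorm 2 (U * diagonal (fun k => (β k : ℂ)) * Uᴴ) ^ 2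
        = ∑ k, ∑ a, ∑ b, ‖slice (X k) M a b‖ ^ 2 := by
      rw [← star_eq_conjTranspose, schattenNorm_unitary_mul_mul 2 hU (Unitary.star_mem hU),
        schattenNorm_two_sq]
      refine Finset.sum_congr rfl fun k _ => ?_
      rw [Finset.sum_eq_single k (fun j _ hj => by simp [diagonal_apply_ne _ hj.symm]) (by simp),
        diagonal_apply_eq, Complex.norm_real, Real.norm_of_nonneg (schattenNorm_nonneg _ _),
        schattenNorm_two_sq]
    rw [hdiag, schattenNorm_two_sq_eq_sum_blocks, Finset.sum_comm]
    refine Finset.sum_le_sum fun a _ => ?_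
    rw [Finset.sum_comm]
    refine Finset.sum_le_sum fun b _ => ?_
    rw [← schattenNorm_unitary_mul_mul 2 (Unitary.star_mem hU) hU, schattenNorm_two_sq]
    refine Finset.sum_le_sum fun k _ => ?_
    rw [slice_apply, hX, trace_mul_conj_single]
    exact Finset.single_le_sum
      (f := fun j => ‖(star U * (of fun i j => M (i, a) (j, b)) * U) k j‖ ^ 2)
      (fun j _ => by positivity) (Finset.mem_univ k)
  · intro k
    rw [hX, trace_mul_conj_single]
    rw [show Uᴴ * (U * diagonal (fun k => (β k : ℂ)) * Uᴴ) * U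
      = (Uᴴ * U) * diagonal (fun k => (β k : ℂ)) * (Uᴴ * U) by simp only [Matrix.mul_assoc], hUU]
    simp

theorem Lp_finset_sum_le {ι κ : Type*} [Fintype κ] {r : ℝ} (hr : 1 ≤ r) (t : Finset ι)
    {f : ι → κ → ℝ} (hf : ∀ i k, 0 ≤ f i k) :
    (∑ k, (∑ i ∈ t, f i k) ^ r) ^ (1 / r) ≤ ∑ i ∈ t, (∑ k, f i k ^ r) ^ (1 / r) := by
  classical
  induction t using Finset.induction_on with
  | empty =>
    have h : r ≠ 0 := by linarith
    simp [Real.zero_rpow h, Real.zero_rpow (inv_ne_zero h)]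
  | insert i t hi ih =>
    simp only [Finset.sum_insert hi]
    refine (Real.Lp_add_le_of_nonneg Finset.univ hr (fun k _ => hf i k)
      (fun k _ => Finset.sum_nonneg fun i _ => hf i k)).trans ?_
    gcongr

/-- Minkowski's inequality in `ℓ_{q/2}`, which exchanges an `ℓ_2` norm and an `ℓ_q` norm. -/
theorem Lq_sqrt_sum_sq_le {ι κ : Type*} [Fintype ι] [Fintype κ] (hq : 2 ≤ q) {f : ι → κ → ℝ}
    (hf : ∀ i k, 0 ≤ f i k) {g : ι → ℝ} (hg : ∀ i, (∑ k, f i k ^ q) ^ (1 / q) ≤ g i) :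
    (∑ k, √(∑ i, f i k ^ 2) ^ q) ^ (1 / q) ≤ √(∑ i, g i ^ 2) := by
  have hq0 : 0 < q := by linarith
  have hsq : ∀ z : ℝ, 0 ≤ z → (z ^ 2) ^ (q / 2) = z ^ q := fun z hz => by
    rw [← Real.rpow_natCast, ← Real.rpow_mul hz]; congr 1; push_cast; ring
  have hroot : ∀ z : ℝ, 0 ≤ z → z ^ (1 / (q / 2)) = (z ^ (1 / q)) ^ 2 := fun z hz => by
    rw [← Real.rpow_natCast, ← Real.rpow_mul hz]; congr 1; push_cast; field_simp
  have h := Lp_finset_sum_le (r := q / 2) (by linarith) Finset.univ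
    (f := fun i k => f i k ^ 2) fun i k => by positivity
  have hnn : ∀ i, 0 ≤ ∑ k, f i k ^ q := fun i =>
    Finset.sum_nonneg fun k _ => Real.rpow_nonneg (hf i k) _
  have hlhs : ∀ k, (∑ i, f i k ^ 2) ^ (q / 2) = √(∑ i, f i k ^ 2) ^ q := fun k => by
    rw [← hsq _ (Real.sqrt_nonneg _), Real.sq_sqrt (by positivity)]
  simp only [hlhs, hsq _ (hf _ _), hroot _ (hnn _)] at h
  rw [hroot _ (Finset.sum_nonneg fun k _ => Real.rpow_nonneg (Real.sqrt_nonneg _) _)] at h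
  refine Real.le_sqrt_of_sq_le (h.trans (Finset.sum_le_sum fun i _ => ?_))
  exact pow_le_pow_left₀ (Real.rpow_nonneg (hnn i) _) (hg i) 2

/-- When the `R k` are the projections onto an orthonormal basis, `Φ` is in effect a map into `ℓ_q`,
and its tensor product with the identity of a Hilbert space has the same norm. -/
theorem schattenNorm_tensorMap_ebMap_le_of_right_projections (hq : 2 < q)
    {U : Matrix (Fin d') (Fin d') ℂ} (hU : U ∈ unitaryGroup (Fin d') ℂ)
    {R : Fin d' → Matrix (Fin d') (Fin d') ℂ} (hR : ∀ k, R k = U * single k k 1 * Uᴴ)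
    {X : Fin d' → Matrix (Fin d) (Fin d) ℂ} (hx : 0 ≤ x) (hy : 0 ≤ y)
    (hΦ : ∀ A, schattenNorm q (ebMap X R A) ≤ x * schattenNorm 2 A)
    (hΩ : ∀ B, schattenNorm q (Ω B) ≤ y * schattenNorm 2 B)
    (M : Matrix (Fin d × m) (Fin d × m) ℂ) :
    schattenNorm q (tensorMap (ebMap X R) Ω M) ≤ x * y * schattenNorm 2 M := by
  have hRpos : ∀ k, (R k).PosSemidef := fun k => hR k ▸ posSemidef_conj_single U k
  have h := schattenNorm_tensorMap_ebMap_le (by linarith) hRpos hy hΩ (X := X) (M := M)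
    (b := fun k => schattenNorm 2 (slice (X k) M)) fun k => le_rfl
  have hnorm : ∀ c : Fin d' → ℂ, schattenNorm q (∑ k, c k • R k) = (∑ k, ‖c k‖ ^ q) ^ (1 / q) := by
    intro c
    simp only [hR]
    rw [sum_smul_conj_single, schattenNorm_conj_diagonal q hU]
  rw [hnorm] at h
  let block : m × m → Matrix (Fin d) (Fin d) ℂ := fun p => of fun i j => M (i, p.1) (j, p.2)
  have hmink := Lq_sqrt_sum_sq_le hq.le (f := fun p k => ‖(block p * X k).trace‖)
    (g := fun p => x * schattenNorm 2 (block p)) (fun _ _ => norm_nonneg _) fun p => by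
      rw [← hnorm]
      exact hΦ (block p)
  have hM : √(∑ p, (x * schattenNorm 2 (block p)) ^ 2) = x * schattenNorm 2 M := by
    simp only [mul_pow, ← Finset.mul_sum, Fintype.sum_prod_type]
    rw [← schattenNorm_two_sq_eq_sum_blocks, ← mul_pow,
      Real.sqrt_sq (mul_nonneg hx (schattenNorm_nonneg _ _))]
  have hslice : ∀ k, ‖(schattenNorm 2 (slice (X k) M) : ℂ)‖
      = √(∑ p, ‖(block p * X k).trace‖ ^ 2) := by
    intro k
    rw [Complex.norm_real, Real.norm_of_nonneg (schattenNorm_nonneg _ _), schattenNorm_two,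
      Fintype.sum_prod_type]
    simp only [slice_apply, block]
  simp only [hslice] at h
  rw [hM] at hmink
  calc _ ≤ y * (x * schattenNorm 2 M) := h.trans (mul_le_mul_of_nonneg_left hmink hy)
    _ = _ := by ring

/-- A map with diagonal `R k` can be rewritten with the diagonal matrix units in place of the `R k`.
-/
theorem ebMap_eq_of_diagonal (hR : ∀ k i j, i ≠ j → R k i j = 0) :
    ebMap X R = ebMap (fun i => ∑ k, R k i i • X k) fun i : Fin d' => single i i 1 := by
  ext1 A
  simp only [ebMap, LinearMap.coe_mk, AddHom.coe_mk, Matrix.mul_sum, mul_smul_comm, trace_sum,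
    trace_smul, smul_eq_mul]
  ext i j
  rw [Matrix.sum_apply, Matrix.sum_apply]
  by_cases h : i = j
  · subst h
    rw [Finset.sum_eq_single i (fun l _ hl => by simp [hl]) (by simp)]
    simp [mul_comm]
  · rw [Finset.sum_eq_zero fun k _ => by simp [hR k i j h],
      Finset.sum_eq_zero fun l _ => by
        have : ¬ (l = i ∧ l = j) := fun hl => h (hl.1.symm.trans hl.2)
        simp [this]]

/-- Rank-one projections onto an orthonormal basis are the unitary conjugates of the diagonal matrix
units. The bijection `e` is arbitrary, so that it can be taken to be the identity once `N` has been
replaced by `d`. -/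
theorem IsBasisProjections.exists_unitary {X : Fin N → Matrix (Fin d) (Fin d) ℂ}
    (h : IsBasisProjections X) : N = d ∧ ∀ e : Fin N ≃ Fin d,
      ∃ U ∈ unitaryGroup (Fin d) ℂ, ∀ k, X k = U * single (e k) (e k) 1 * Uᴴ := by
  obtain ⟨ψ, hψ⟩ := h
  refine ⟨by simpa using (Module.finrank_eq_card_basis ψ.toBasis).symm, fun e => ?_⟩
  refine ⟨of fun i k => ψ (e.symm k) i, ?_, fun k => ?_⟩
  · rw [mem_unitaryGroup_iff']
    ext i j
    have := orthonormal_iff_ite.1 ψ.orthonormal (e.symm i) (e.symm j)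
    rw [star_eq_conjTranspose, mul_apply, one_apply]
    simp only [EmbeddingLike.apply_eq_iff_eq] at this
    rw [← this]
    simp [PiLp.inner_apply, mul_comm]
  · rw [hψ]
    ext i j
    rw [Matrix.mul_apply, Finset.sum_eq_single (e k)]
    · simp
    · intro l _ hl
      simp [Matrix.mul_apply, hl.symm]
    · simp

end Bounds

section Main

variable {d d' N : ℕ} {m n : Type*} [Fintype m] [DecidableEq m] [Fintype n] [DecidableEq n]
  {X : Fin N → Matrix (Fin d) (Fin d) ℂ} {R : Fin N → Matrix (Fin d') (Fin d') ℂ}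
  {q : ℝ}

theorem normPQ_two_tensorMap_ebMap_le (hq : 2 < q) (hR : ∀ k, (R k).PosSemidef)
    (h : (∀ k i j, 0 ≤ X k i j) ∨ ∀ k i j, i ≠ j → R k i j = 0)
    (Ω : Matrix m m ℂ →ₗ[ℂ] Matrix n n ℂ) :
    normPQ 2 q (tensorMap (ebMap X R) Ω) ≤ normPQ 2 q (ebMap X R) * normPQ 2 q Ω := by
  refine normPQ_tensorMap_le two_pos (by linarith) fun x y hx hy hΦ hΩ M => ?_
  rcases h with h | h
  · exact schattenNorm_tensorMap_ebMap_le_of_entries_nonneg (by linarith) hR h hx hy hΦ hΩ M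
  · rw [ebMap_eq_of_diagonal h] at hΦ ⊢
    exact schattenNorm_tensorMap_ebMap_le_of_right_projections hq (one_mem _)
      (fun k => by simp) hx hy hΦ hΩ M

theorem normPQ_two_tensorMap_ebMap_le_of_projections (hq : 2 < q) (hR : ∀ k, (R k).PosSemidef)
    (h : IsBasisProjections X ∨ IsBasisProjections R)
    (Ω : Matrix m m ℂ →ₗ[ℂ] Matrix n n ℂ) :
    normPQ 2 q (tensorMap (ebMap X R) Ω) ≤ normPQ 2 q (ebMap X R) * normPQ 2 q Ω := by
  refine normPQ_tensorMap_le two_pos (by linarith) fun x y hx hy hΦ hΩ M => ?_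
  rcases h with h | h
  · obtain ⟨rfl, h⟩ := h.exists_unitary
    obtain ⟨U, hU, hX⟩ := h (Equiv.refl _)
    exact schattenNorm_tensorMap_ebMap_le_of_left_projections (by linarith) hR hU hX hx hy hΦ hΩ M
  · obtain ⟨rfl, h⟩ := h.exists_unitary
    obtain ⟨U, hU, hR'⟩ := h (Equiv.refl _)
    exact schattenNorm_tensorMap_ebMap_le_of_right_projections hq hU hR' hx hy hΦ hΩ M

theorem normPQ_tensorMap_ebMap_two_le {p : ℝ} (hp : 1 < p) (hp2 : p < 2)
    (hX : ∀ k, (X k).PosSemidef)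
    (h : (∀ k i j, 0 ≤ R k i j) ∨ ∀ k i j, i ≠ j → X k i j = 0)
    (Ω : Matrix m m ℂ →ₗ[ℂ] Matrix n n ℂ) :
    normPQ p 2 (tensorMap (ebMap X R) Ω) ≤ normPQ p 2 (ebMap X R) * normPQ p 2 Ω := by
  obtain ⟨Ω', hΩ⟩ := exists_isTracePair Ω
  have hpq := Real.HolderConjugate.conjExponent hp
  have h22 : (2 : ℝ).HolderConjugate 2 := Real.HolderConjugate.two_two
  have hq : 2 < p.conjExponent := by
    rw [Real.conjExponent, lt_div_iff₀ (by linarith)]; linarith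
  have hΦ := isTracePair_ebMap X R
  calc _ ≤ normPQ 2 p.conjExponent (tensorMap (ebMap R X) Ω') := (hΦ.tensorMap hΩ).normPQ_le hpq h22
    _ ≤ normPQ 2 p.conjExponent (ebMap R X) * normPQ 2 p.conjExponent Ω' :=
        normPQ_two_tensorMap_ebMap_le hq hX h Ω'
    _ ≤ _ := mul_le_mul' (hΦ.symm.normPQ_le h22 hpq.symm) (hΩ.symm.normPQ_le h22 hpq.symm)

end Main

end MatrixMaps

theorem theorem1 (d d' N : ℕ)
    (X : Fin N → Matrix (Fin d) (Fin d) ℂ) (R : Fin N → Matrix (Fin d') (Fin d') ℂ)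
    (hX : ∀ k, (X k).PosSemidef) (hR : ∀ k, (R k).PosSemidef) :
    (((∀ k i j, 0 ≤ X k i j) ∨ (∀ k i j, i ≠ j → R k i j = 0)) →
      ∀ q : ℝ, 2 < q → MatrixMaps.FullyMultiplicative 2 q (MatrixMaps.ebMap X R)) ∧
    ((MatrixMaps.IsBasisProjections X ∨ MatrixMaps.IsBasisProjections R) →
      ∀ q : ℝ, 2 < q → MatrixMaps.FullyMultiplicative 2 q (MatrixMaps.ebMap X R)) ∧
    (((∀ k i j, 0 ≤ R k i j) ∨ (∀ k i j, i ≠ j → X k i j = 0)) →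
      ∀ p : ℝ, 1 ≤ p → p < 2 →
        MatrixMaps.FullyMultiplicative p 2 (MatrixMaps.ebMap X R)) := by
  refine ⟨fun h q hq e e' Ω _ => ?_, fun h q hq e e' Ω _ => ?_, fun h p hp hp2 e e' Ω _ => ?_⟩
  · exact le_antisymm (MatrixMaps.normPQ_two_tensorMap_ebMap_le hq hR h Ω)
      (MatrixMaps.mul_normPQ_le_normPQ_tensorMap _ _ _ _)
  · exact le_antisymm (MatrixMaps.normPQ_two_tensorMap_ebMap_le_of_projections hq hR h Ω)
      (MatrixMaps.mul_normPQ_le_normPQ_tensorMap _ _ _ _)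
  · refine le_antisymm ?_ (MatrixMaps.mul_normPQ_le_normPQ_tensorMap _ _ _ _)
    rcases hp.eq_or_lt with rfl | hp
    · exact MatrixMaps.normPQ_one_tensorMap_le one_lt_two two_pos fun p hp hp2 =>
        MatrixMaps.normPQ_tensorMap_ebMap_two_le hp hp2 hX h Ω
    · exact MatrixMaps.normPQ_tensorMap_ebMap_two_le hp hp2 hX h Ω
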